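/- Let $f_0,\rho_0\in C^\infty([0,1])$ satisfy $f_0(0)=f_0(1)=0$, $\rho_0(0)=\rho_0(1)=0$ and $\rho_0\ge 0$ on $[0,1]$. Let $M_0=\max_{x\in[0,1]}f_0'(x)$ and suppose that $M_0>0$, that $f_0'$ attains the value $M_0$ only at boundary points (one or both) $x_i^*\in\{0,1\}$, and that $f_0''(x_i^*)\neq 0$ at each of these points (derivatives at the endpoints are one-sided). Consider the initial boundary value problem $$ \begin{cases} f_{xt}+ff_{xx}-f_x^2+\rho=I(t), & x\in[0,1],\ t>0,\\ \rho_t+f\rho_x=\rho f_x, & x\in[0,1],\ t>0,\\ I(t)=\int_0^1\rho\,dx-2\int_0^1 f_x^2\,dx, & t>0,\\ f(0,x)=f_0(x),\quad \rho(0,x)=\rho_0(x), & x\in[0,1],\\ f(t,0)=f(t,1)=0,\quad \rho(t,0)=\rho(t,1)=0 . \end{cases} $$ By a classical solution on $[0,T)$ we mean a pair $(f,\rho)$ satisfying these relations for $t<T$, with $f,f_x,f_{xx},\rho,\rho_x$ continuous on $[0,T)\times[0,1]$ and such that $f_{xt},\rho_t$ exist for $0<t<T$. Then there is a finite $t^*>0$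 such that the problem has a classical solution $(f,\rho)$ on $[0,t^*)$; every classical solution on an interval $[0,T)$ has $T\le t^*$ and coincides with $(f,\rho)$ on $[0,T)\times[0,1]$; and, at every point $x_i^*$ where $f_0'(x_i^*)=M_0$, $$ \lim_{t\nearrow t^*}\int_0^t f_x(s,x_i^*)\,ds=+\infty . $$ Moreover the following limit exists and is finite, and $$ t^*\le \lim_{\eta\nearrow 1/M_0}\int_0^{\eta}\left(\int_0^1\frac{dx}{1-\mu f_0'(x)}\right)^{2}d\mu . $$ -/

import Mathlib

open Set Filter Topology MeasureTheory
open scoped ContDiff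

noncomputable section

/-- Derivative of a function of `x ∈ [0,1]`, one-sided at the two endpoints. -/
def dX (u : ℝ → ℝ) (x : ℝ) : ℝ := derivWithin u (Icc 0 1) x

/-- The nonlocal term `I(t) = ∫₀¹ ρ dx - 2 ∫₀¹ f_x² dx`, for the time slices
`u = f(t,·)` and `r = ρ(t,·)`. -/
def nonlocalI (u r : ℝ → ℝ) : ℝ :=
  (∫ x in (0 : ℝ)..1, r x) - 2 * ∫ x in (0 : ℝ)..1, (dX u x) ^ 2

/-- `(f, ρ)`, written `f t x` and `ρ t x`, is a classical solution on `[0,T) × [0,1]` of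

* `f_xt + f f_xx - f_x² + ρ = I(t)`,
* `ρ_t + f ρ_x = ρ f_x`,
* `I(t) = ∫₀¹ ρ dx - 2 ∫₀¹ f_x² dx`,

with initial data `(f₀, ρ₀)` and Dirichlet boundary conditions `f = ρ = 0` at `x = 0, 1`. The
functions `f, f_x, f_xx, ρ, ρ_x` are continuous on `[0,T) × [0,1]`, and `f_xt, ρ_t` exist for
`0 < t < T`. -/
structure IsDirichletSolution (f₀ ρ₀ : ℝ → ℝ) (T : ℝ) (f ρ : ℝ → ℝ → ℝ) : Prop where
  diff_f : ∀ t ∈ Ico 0 T, DifferentiableOn ℝ (f t) (Icc 0 1)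
  diff_fx : ∀ t ∈ Ico 0 T, DifferentiableOn ℝ (dX (f t)) (Icc 0 1)
  diff_rho : ∀ t ∈ Ico 0 T, DifferentiableOn ℝ (ρ t) (Icc 0 1)
  cont_f : ContinuousOn (fun p : ℝ × ℝ => f p.1 p.2) (Ico 0 T ×ˢ Icc 0 1)
  cont_fx : ContinuousOn (fun p : ℝ × ℝ => dX (f p.1) p.2) (Ico 0 T ×ˢ Icc 0 1)
  cont_fxx : ContinuousOn (fun p : ℝ × ℝ => dX (dX (f p.1)) p.2) (Ico 0 T ×ˢ Icc 0 1)
  cont_rho : ContinuousOn (fun p : ℝ × ℝ => ρ p.1 p.2) (Ico 0 T ×ˢ Icc 0 1)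
  cont_rhox : ContinuousOn (fun p : ℝ × ℝ => dX (ρ p.1) p.2) (Ico 0 T ×ˢ Icc 0 1)
  diff_t_fx : ∀ t ∈ Ioo 0 T, ∀ x ∈ Icc (0 : ℝ) 1, DifferentiableAt ℝ (fun s => dX (f s) x) t
  diff_t_rho : ∀ t ∈ Ioo 0 T, ∀ x ∈ Icc (0 : ℝ) 1, DifferentiableAt ℝ (fun s => ρ s x) t
  eq_f : ∀ t ∈ Ioo 0 T, ∀ x ∈ Icc (0 : ℝ) 1,
    deriv (fun s => dX (f s) x) t + f t x * dX (dX (f t)) x - (dX (f t) x) ^ 2 + ρ t x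
      = nonlocalI (f t) (ρ t)
  eq_rho : ∀ t ∈ Ioo 0 T, ∀ x ∈ Icc (0 : ℝ) 1,
    deriv (fun s => ρ s x) t + f t x * dX (ρ t) x = ρ t x * dX (f t) x
  init_f : ∀ x ∈ Icc (0 : ℝ) 1, f 0 x = f₀ x
  init_rho : ∀ x ∈ Icc (0 : ℝ) 1, ρ 0 x = ρ₀ x
  bdry_f : ∀ t ∈ Ico 0 T, f t 0 = 0 ∧ f t 1 = 0
  bdry_rho : ∀ t ∈ Ico 0 T, ρ t 0 = 0 ∧ ρ t 1 = 0

end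

/-! The problem becomes linear in Lagrangian coordinates. Let `γ` be the flow of `f` and write `γ_x
= 1/w`. Then `f_x ∘ γ = -w_t/w`, the second equation says `ρ ∘ γ = ρ₀/w`, and the first becomes
`w_tt + I(t) w = ρ₀` with `w = 1`, `w_t = -f₀'` at `t = 0`. The space variable enters only through
`F = f₀'` and `R = ρ₀`, so `w = a(t) + b(t) F + p(t) R`. Since `γ` maps `[0,1]` onto itself, `∫ dx/w
= 1`, and differentiating this constraint twice gives back the nonlocal formula for `I`
(`IsFlowCoeff.coeff_eq`).

The system for `a, b, p` is solved by taking `η = -b/a` as new time. Put `w = φ (1 - η F + Q R)`.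
The constraint forces `φ = ∫ dx/(1 - η F + Q R)`, the Wronskian of `a` and `b` gives `dη/dt = φ⁻²`,
and the equation for `p = φ Q` becomes `d²Q/dη² = φ³`. This is a scalar second-order ODE, globally
solvable for `η < 1/M` (`exists_mass_ode_solution`). As `Q'' > 0`, `Q ≥ 0`; together with `R ≥ 0`
this gives `φ ≤ Φ(η) = ∫ dx/(1 - η F)`. The lifespan `∫ φ² dη` over `[0, 1/M)` is therefore at most
`∫ Φ² dη`, which is the stated bound (`exists_time_change`, `exists_flowCoeff`).

The condition `f₀'' ≠ 0` at the maxima makes `M - F` at least of the order of the distance to the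
boundary. Hence `Φ` is only weakly singular: it is `O((1 - η M)^(-1/4))`, so `Φ²` is integrable and
`(1 - η M) Φ → 0`. At a maximum point, an endpoint where `R = 0`, `w = φ (1 - η M)` thus tends to
`0`. Endpoints are fixed by the flow, so `∫ f_x dt = -log w → +∞` there.

Conversely, `IsFlowCoeff.exists_solution` turns such a `w` into a classical solution through the
inverse flow. Uniqueness is an `L²` energy estimate for the differences of `f_x` and `ρ`, in which
the nonlocal term drops out. A solution living beyond the blowup time would coincide with this one
and have bounded `f_x` up to that time, which is impossible. -/

/-! ### Integrals depending on a parameter. -/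

theorem continuousOn_slice {S : Set ℝ} {h : ℝ → ℝ → ℝ}
    (hh : ContinuousOn (fun p : ℝ × ℝ => h p.1 p.2) (S ×ˢ Icc 0 1)) {t : ℝ} (ht : t ∈ S) :
    ContinuousOn (h t) (Icc 0 1) :=
  hh.comp (f := fun x : ℝ => (t, x)) (by fun_prop) fun _ hx => ⟨ht, hx⟩

theorem continuousOn_slice_left {S : Set ℝ} {h : ℝ → ℝ → ℝ}
    (hh : ContinuousOn (fun p : ℝ × ℝ => h p.1 p.2) (S ×ˢ Icc 0 1)) {x : ℝ}
    (hx : x ∈ Icc (0 : ℝ) 1) : ContinuousOn (fun t => h t x) S :=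
  hh.comp (f := fun t : ℝ => (t, x)) (by fun_prop) fun _ ht => ⟨ht, hx⟩

theorem uIcc_subset_unit {c : ℝ} (hc : c ∈ Icc (0 : ℝ) 1) : uIcc 0 c ⊆ Icc 0 1 := by
  rw [uIcc_of_le hc.1]
  exact Icc_subset_Icc le_rfl hc.2

theorem intervalIntegrable_of_continuousOn_unit {h : ℝ → ℝ} (hh : ContinuousOn h (Icc 0 1))
    {c : ℝ} (hc : c ∈ Icc (0 : ℝ) 1) : IntervalIntegrable h volume 0 c :=
  (hh.mono (uIcc_subset_unit hc)).intervalIntegrable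

theorem continuousOn_integral_joint {S : Set ℝ} {h : ℝ → ℝ → ℝ}
    (hh : ContinuousOn (fun p : ℝ × ℝ => h p.1 p.2) (S ×ˢ Icc 0 1)) :
    ContinuousOn (fun p : ℝ × ℝ => ∫ x in (0 : ℝ)..p.2, h p.1 x) (S ×ˢ Icc 0 1) := by
  rw [continuousOn_iff_continuous_domRestrict]
  -- Composing with `projIcc` extends the integrand continuously to all real `x` without changing it
  -- on `[0,1]`; the parameter stays in the subtype.
  have h1 : Continuous (Function.uncurry fun (q : ↥(S ×ˢ Icc (0 : ℝ) 1)) (x : ℝ) =>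
      h q.1.1 (projIcc (0 : ℝ) 1 zero_le_one x)) := by
    refine hh.comp_continuous (f := fun r : ↥(S ×ˢ Icc (0 : ℝ) 1) × ℝ =>
      (r.1.1.1, (projIcc (0 : ℝ) 1 zero_le_one r.2 : ℝ))) ?_ ?_
    · exact (by fun_prop : Continuous fun r : ↥(S ×ˢ Icc (0 : ℝ) 1) × ℝ => r.1.1.1).prodMk
        (continuous_subtype_val.comp (continuous_projIcc.comp continuous_snd))
    · intro r
      exact ⟨r.1.2.1, (projIcc (0 : ℝ) 1 zero_le_one r.2).2⟩
  have h2 := intervalIntegral.continuous_parametric_intervalIntegral_of_continuous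
    (μ := volume) (a₀ := 0) h1 (s := fun q => q.1.2) (by fun_prop)
  refine h2.congr fun q => ?_
  refine intervalIntegral.integral_congr fun x hx => ?_
  have := uIcc_subset_unit q.2.2 hx
  simp [projIcc_of_mem zero_le_one this]

theorem continuousOn_integral_unit {S : Set ℝ} {h : ℝ → ℝ → ℝ}
    (hh : ContinuousOn (fun p : ℝ × ℝ => h p.1 p.2) (S ×ˢ Icc 0 1)) :
    ContinuousOn (fun t => ∫ x in (0 : ℝ)..1, h t x) S :=
  continuousOn_slice_left (h := fun t c => ∫ x in (0 : ℝ)..c, h t x)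
    (continuousOn_integral_joint hh) (right_mem_Icc.2 zero_le_one)

theorem hasDerivAt_integral_of_continuousOn {a b : ℝ} {h h' : ℝ → ℝ → ℝ}
    (hh : ContinuousOn (fun p : ℝ × ℝ => h p.1 p.2) (Ioo a b ×ˢ Icc 0 1))
    (hh' : ContinuousOn (fun p : ℝ × ℝ => h' p.1 p.2) (Ioo a b ×ˢ Icc 0 1))
    (hd : ∀ t ∈ Ioo a b, ∀ x ∈ Icc (0 : ℝ) 1, HasDerivAt (fun s => h s x) (h' t x) t)
    {t c : ℝ} (ht : t ∈ Ioo a b) (hc : c ∈ Icc (0 : ℝ) 1) :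
    HasDerivAt (fun s => ∫ x in (0 : ℝ)..c, h s x) (∫ x in (0 : ℝ)..c, h' t x) t := by
  -- On a compact subinterval of times around `t` the derivative is bounded by a constant, which
  -- serves as the dominating function.
  obtain ⟨a', ha', ha't⟩ := exists_between ht.1
  obtain ⟨b', htb', hb'⟩ := exists_between ht.2
  have hsub : Icc a' b' ⊆ Ioo a b := fun s hs => ⟨ha'.trans_le hs.1, hs.2.trans_lt hb'⟩
  obtain ⟨K, hK⟩ := (isCompact_Icc.prod isCompact_Icc).exists_bound_of_continuousOn
    (hh'.mono (prod_mono_left (t := Icc (0 : ℝ) 1) hsub))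
  have hu : uIoc 0 c ⊆ Icc 0 1 := uIoc_subset_uIcc.trans (uIcc_subset_unit hc)
  have hsm : ∀ {k : ℝ → ℝ}, ContinuousOn k (Icc 0 1) →
      AEStronglyMeasurable k (volume.restrict (uIoc 0 c)) := fun hk =>
    (hk.mono hu).aestronglyMeasurable measurableSet_uIoc
  refine (intervalIntegral.hasDerivAt_integral_of_dominated_loc_of_deriv_le (𝕜 := ℝ)
    (s := Icc a' b') (bound := fun _ => K) (Icc_mem_nhds ha't htb') ?_ ?_ ?_ ?_ ?_ ?_).2
  · filter_upwards [Ioo_mem_nhds ht.1 ht.2] with s hs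
    exact hsm (continuousOn_slice hh hs)
  · exact intervalIntegrable_of_continuousOn_unit (continuousOn_slice hh ht) hc
  · exact hsm (continuousOn_slice hh' ht)
  · exact Eventually.of_forall fun x hx s hs => hK (s, x) ⟨hs, hu hx⟩
  · exact intervalIntegrable_const
  · exact Eventually.of_forall fun x hx s hs => hd s (hsub hs) x (hu hx)

/-! ### Inverse functions and gluing of ODE solutions. -/

/-- Inverse of a function with positive derivative on an open interval. -/
theorem exists_inverse_of_deriv_pos {a b : ℝ} {τ τ' : ℝ → ℝ}
    (hd : ∀ η ∈ Ioo a b, HasDerivAt τ (τ' η) η) (hpos : ∀ η ∈ Ioo a b, 0 < τ' η) :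
    StrictMonoOn τ (Ioo a b) ∧ ∃ S : ℝ → ℝ, (∀ η ∈ Ioo a b, S (τ η) = η) ∧
      ∀ η ∈ Ioo a b, HasDerivAt S (τ' η)⁻¹ (τ η) := by
  have hc : ContinuousOn τ (Ioo a b) := fun η hη => (hd η hη).continuousAt.continuousWithinAt
  have hmono : StrictMonoOn τ (Ioo a b) := by
    refine strictMonoOn_of_deriv_pos (convex_Ioo a b) hc fun η hη => ?_
    rw [interior_Ioo] at hη
    rw [(hd η hη).deriv]
    exact hpos η hη
  refine ⟨hmono, Function.invFunOn τ (Ioo a b), ?_⟩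
  have hleft : ∀ η ∈ Ioo a b, Function.invFunOn τ (Ioo a b) (τ η) = η := fun η hη =>
    hmono.injOn.leftInvOn_invFunOn hη
  refine ⟨hleft, fun η hη => ?_⟩
  have himg : ∀ η ∈ Ioo a b, τ '' Ioo a b ∈ 𝓝 (τ η) := by
    intro η hη
    obtain ⟨a', ha', ha'η⟩ := exists_between hη.1
    obtain ⟨b', hηb', hb'⟩ := exists_between hη.2
    have hsub : Icc a' b' ⊆ Ioo a b := fun s hs => ⟨ha'.trans_le hs.1, hs.2.trans_lt hb'⟩
    have h1 := intermediate_value_Ioo (ha'η.trans hηb').le (hc.mono hsub)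
    refine mem_of_superset (Ioo_mem_nhds ?_ ?_)
      (h1.trans (image_mono (Ioo_subset_Icc_self.trans hsub)))
    · exact hmono ⟨ha', ha'η.trans hη.2⟩ hη ha'η
    · exact hmono hη ⟨hη.1.trans hηb', hb'⟩ hηb'
  -- The inverse is monotone with image a neighbourhood, and this alone forces its continuity; the
  -- derivative then follows from the local inverse rule.
  have hSm : StrictMonoOn (Function.invFunOn τ (Ioo a b)) (τ '' Ioo a b) := by
    rintro _ ⟨x, hx, rfl⟩ _ ⟨y, hy, rfl⟩ hxy
    rw [hleft x hx, hleft y hy]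
    exact (hmono.lt_iff_lt hx hy).1 hxy
  have hSc : ContinuousAt (Function.invFunOn τ (Ioo a b)) (τ η) := by
    refine hSm.continuousAt_of_image_mem_nhds (himg η hη) ?_
    rw [hleft η hη]
    refine mem_of_superset (Ioo_mem_nhds hη.1 hη.2) fun x hx => ?_
    exact ⟨τ x, mem_image_of_mem _ hx, hleft x hx⟩
  refine HasDerivAt.of_local_left_inverse (f := τ) hSc ?_ (hpos η hη).ne' ?_
  · rw [hleft η hη]
    exact hd η hη
  · filter_upwards [himg η hη]
    rintro _ ⟨x, hx, rfl⟩
    rw [hleft x hx]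

/-- Solutions of an ODE that exist on `(a, c)` for every `c < b` and are unique there glue to a
solution on `(a, b)`. -/
theorem exists_ode_solution_glue {E : Type*} [NormedAddCommGroup E] [NormedSpace ℝ E]
    {v : ℝ → E → E} {a b t₀ : ℝ} {x₀ : E} (hat : a < t₀) (htb : t₀ < b)
    (hlip : ∀ c < b, ∃ K : NNReal, ∀ t ∈ Ioo a c, LipschitzWith K (v t))
    (hex : ∀ c, t₀ < c → c < b →
      ∃ α : ℝ → E, α t₀ = x₀ ∧ ∀ t ∈ Ioo a c, HasDerivAt α (v t (α t)) t) :
    ∃ α : ℝ → E, α t₀ = x₀ ∧ ∀ t ∈ Ioo a b, HasDerivAt α (v t (α t)) t := by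
  choose! α h0 hα using hex
  have huniq : ∀ c c', t₀ < c → c ≤ c' → c' < b → EqOn (α c) (α c') (Ioo a c) := by
    intro c c' hc hcc' hc'
    obtain ⟨K, hK⟩ := hlip c (hcc'.trans_lt hc')
    refine ODE_solution_unique_of_mem_Ioo (v := v) (s := fun _ => univ) (K := K)
      (fun t ht => (hK t ht).lipschitzOnWith) ⟨hat, hc⟩
      (fun t ht => ⟨hα c hc (hcc'.trans_lt hc') t ht, mem_univ _⟩)
      (fun t ht => ⟨hα c' (hc.trans_le hcc') hc' t ⟨ht.1, ht.2.trans_le hcc'⟩, mem_univ _⟩) ?_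
    rw [h0 c hc (hcc'.trans_lt hc'), h0 c' (hc.trans_le hcc') hc']
  -- At time `t` the glued solution uses the one living up to the midpoint of `max t t₀` and `b`;
  -- the maximum guarantees that `t₀` lies in the interval too.
  have hm : ∀ t < b, t₀ < (max t t₀ + b) / 2 ∧ t < (max t t₀ + b) / 2 ∧
      (max t t₀ + b) / 2 < b := by
    intro t ht
    have := le_max_left t t₀
    have := le_max_right t t₀
    have := max_lt ht htb
    refine ⟨?_, ?_, ?_⟩ <;> linarith
  have key : ∀ c, t₀ < c → c < b → ∀ t ∈ Ioo a c, α ((max t t₀ + b) / 2) t = α c t := by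
    intro c hc hcb t ht
    obtain ⟨h1, h2, h3⟩ := hm t (ht.2.trans hcb)
    rcases le_total c ((max t t₀ + b) / 2) with h | h
    · exact (huniq c _ hc h h3 ht).symm
    · exact huniq _ c h1 h hcb ⟨ht.1, h2⟩
  refine ⟨fun t => α ((max t t₀ + b) / 2) t, ?_, fun t ht => ?_⟩
  · exact h0 _ (hm t₀ htb).1 (hm t₀ htb).2.2
  · obtain ⟨h1, h2, h3⟩ := hm t ht.2
    refine (hα _ h1 h3 t ⟨ht.1, h2⟩).congr_of_eventuallyEq ?_
    filter_upwards [Ioo_mem_nhds ht.1 h2] with s hs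
    exact key _ h1 h3 s hs

/-! ### One-sided calculus on the unit interval. -/

theorem uniqueDiffWithinAt_unit {x : ℝ} (hx : x ∈ Icc (0 : ℝ) 1) :
    UniqueDiffWithinAt ℝ (Icc 0 1) x :=
  uniqueDiffOn_Icc zero_lt_one x hx

theorem HasDerivWithinAt.dX_eq {u : ℝ → ℝ} {u' x : ℝ} (h : HasDerivWithinAt u u' (Icc 0 1) x)
    (hx : x ∈ Icc (0 : ℝ) 1) : dX u x = u' :=
  h.derivWithin (uniqueDiffWithinAt_unit hx)

theorem dX_congr {u v : ℝ → ℝ} (h : EqOn u v (Icc 0 1)) : EqOn (dX u) (dX v) (Icc 0 1) :=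
  fun _ hx => derivWithin_congr h (h hx)

theorem integral_eq_sub_of_hasDerivWithinAt_unit {u u' : ℝ → ℝ}
    (hd : ∀ x ∈ Icc (0 : ℝ) 1, HasDerivWithinAt u (u' x) (Icc 0 1) x)
    (hc : ContinuousOn u' (Icc 0 1)) {c : ℝ} (h : c ∈ Icc (0 : ℝ) 1) :
    ∫ x in (0 : ℝ)..c, u' x = u c - u 0 := by
  have hsub : Icc 0 c ⊆ Icc (0 : ℝ) 1 := Icc_subset_Icc le_rfl h.2
  refine intervalIntegral.integral_eq_sub_of_hasDerivAt_of_le h.1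
    (fun x hx => ((hd x (hsub hx)).continuousWithinAt).mono hsub) (fun x hx => ?_)
    (intervalIntegrable_of_continuousOn_unit hc h)
  exact (hd x (hsub (Ioo_subset_Icc_self hx))).hasDerivAt
    (Icc_mem_nhds hx.1 (hx.2.trans_le h.2))

theorem integral_mono_unit {u v : ℝ → ℝ} (hu : ContinuousOn u (Icc 0 1))
    (hv : ContinuousOn v (Icc 0 1)) (h : ∀ x ∈ Icc (0 : ℝ) 1, u x ≤ v x) :
    ∫ x in (0 : ℝ)..1, u x ≤ ∫ x in (0 : ℝ)..1, v x :=
  intervalIntegral.integral_mono_on zero_le_one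
    (intervalIntegrable_of_continuousOn_unit hu (right_mem_Icc.2 zero_le_one))
    (intervalIntegrable_of_continuousOn_unit hv (right_mem_Icc.2 zero_le_one)) h

/-- Poincaré-type inequality for a function vanishing at `0`. -/
theorem sq_le_integral_sq {w u : ℝ → ℝ}
    (hd : ∀ x ∈ Icc (0 : ℝ) 1, HasDerivWithinAt w (u x) (Icc 0 1) x)
    (hu : ContinuousOn u (Icc 0 1)) (hw : w 0 = 0) {x : ℝ} (hx : x ∈ Icc (0 : ℝ) 1) :
    (w x) ^ 2 ≤ ∫ y in (0 : ℝ)..1, (u y) ^ 2 := by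
  have h1 : w x = ∫ y in (0 : ℝ)..x, u y := by
    rw [integral_eq_sub_of_hasDerivWithinAt_unit hd hu hx, hw, sub_zero]
  have hI : IntervalIntegrable (fun y => |u y|) volume 0 1 :=
    intervalIntegrable_of_continuousOn_unit hu.abs (right_mem_Icc.2 zero_le_one)
  have h2 : |w x| ≤ ∫ y in (0 : ℝ)..1, |u y| := by
    rw [h1]
    refine (intervalIntegral.abs_integral_le_integral_abs hx.1).trans ?_
    exact intervalIntegral.integral_mono_interval le_rfl hx.1 hx.2
      (Eventually.of_forall fun _ => abs_nonneg _) hI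
  set N := ∫ y in (0 : ℝ)..1, |u y| with hN
  -- Cauchy–Schwarz in the form `∫ (|u| - N)² ≥ 0`, with `N` the mean of `|u|`.
  have h3 : ∫ y in (0 : ℝ)..1, (2 * N * |u y| - N ^ 2) ≤ ∫ y in (0 : ℝ)..1, (u y) ^ 2 := by
    refine integral_mono_unit (by fun_prop) (by fun_prop) fun y _ => ?_
    rw [← sq_abs (u y)]
    nlinarith [sq_nonneg (|u y| - N)]
  rw [intervalIntegral.integral_sub (hI.const_mul _) intervalIntegrable_const,
    intervalIntegral.integral_const_mul, ← hN, intervalIntegral.integral_const] at h3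
  have h4 : (w x) ^ 2 ≤ N ^ 2 := sq_le_sq' (abs_le.1 h2).1 (abs_le.1 h2).2
  simp only [smul_eq_mul] at h3
  nlinarith

/-! ### Energy estimate and uniqueness. -/

/-- Here `w`, `u`, `r` stand for the differences of `f`, `f_x`, `ρ` of two solutions, `J` for the
difference of the nonlocal terms, `G`, `σ`, `σ₁` for `f_xx`, `ρ`, `ρ_x` of the second solution and
`s` for the sum of the two `f_x`. The term in `J` contributes `2 J ∫ u = 0` because `w` vanishes at
both ends. The transport terms form an exact derivative up to `f₁ (u² + r²)`, so no derivative of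
`u` or `r` has to be bounded. The rest is quadratic in `u`, `r`, `w`, and `w²` is controlled by the
energy through `sq_le_integral_sq`. -/
theorem energy_production_le {f f₁ u u₁ r r₁ w G σ σ₁ s : ℝ → ℝ} {J K : ℝ}
    (hf : ∀ x ∈ Icc (0 : ℝ) 1, HasDerivWithinAt f (f₁ x) (Icc 0 1) x)
    (hu : ∀ x ∈ Icc (0 : ℝ) 1, HasDerivWithinAt u (u₁ x) (Icc 0 1) x)
    (hr : ∀ x ∈ Icc (0 : ℝ) 1, HasDerivWithinAt r (r₁ x) (Icc 0 1) x)
    (hw : ∀ x ∈ Icc (0 : ℝ) 1, HasDerivWithinAt w (u x) (Icc 0 1) x)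
    (cf₁ : ContinuousOn f₁ (Icc 0 1)) (cu₁ : ContinuousOn u₁ (Icc 0 1))
    (cr₁ : ContinuousOn r₁ (Icc 0 1)) (cG : ContinuousOn G (Icc 0 1))
    (cσ : ContinuousOn σ (Icc 0 1)) (cσ₁ : ContinuousOn σ₁ (Icc 0 1))
    (cs : ContinuousOn s (Icc 0 1))
    (hf0 : f 0 = 0) (hf1 : f 1 = 0) (hw0 : w 0 = 0) (hw1 : w 1 = 0)
    (bf₁ : ∀ x ∈ Icc (0 : ℝ) 1, |f₁ x| ≤ K) (bG : ∀ x ∈ Icc (0 : ℝ) 1, |G x| ≤ K)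
    (bσ : ∀ x ∈ Icc (0 : ℝ) 1, |σ x| ≤ K) (bσ₁ : ∀ x ∈ Icc (0 : ℝ) 1, |σ₁ x| ≤ K)
    (bs : ∀ x ∈ Icc (0 : ℝ) 1, |s x| ≤ 2 * K) :
    ∫ x in (0 : ℝ)..1, (2 * u x * (-f x * u₁ x - w x * G x + s x * u x - r x + J)
        + 2 * r x * (r x * f₁ x + σ x * u x - f x * r₁ x - w x * σ₁ x))
      ≤ (12 * K + 1) * ∫ x in (0 : ℝ)..1, ((u x) ^ 2 + (r x) ^ 2) := by
  have h1 : (1 : ℝ) ∈ Icc (0 : ℝ) 1 := right_mem_Icc.2 zero_le_one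
  have cf : ContinuousOn f (Icc 0 1) := fun x hx => (hf x hx).continuousWithinAt
  have cu : ContinuousOn u (Icc 0 1) := fun x hx => (hu x hx).continuousWithinAt
  have cr : ContinuousOn r (Icc 0 1) := fun x hx => (hr x hx).continuousWithinAt
  have cw : ContinuousOn w (Icc 0 1) := fun x hx => (hw x hx).continuousWithinAt
  have hK : 0 ≤ K := (abs_nonneg _).trans (bf₁ 0 (left_mem_Icc.2 zero_le_one))
  set E := ∫ x in (0 : ℝ)..1, ((u x) ^ 2 + (r x) ^ 2) with hE
  have cE : ContinuousOn (fun x => (u x) ^ 2 + (r x) ^ 2) (Icc 0 1) := by fun_prop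
  have hIJ : ∫ x in (0 : ℝ)..1, u x = 0 := by
    rw [integral_eq_sub_of_hasDerivWithinAt_unit hw cu h1, hw0, hw1, sub_zero]
  have hdiv : ∫ x in (0 : ℝ)..1, (f₁ x * ((u x) ^ 2 + (r x) ^ 2)
      + f x * (2 * u x * u₁ x + 2 * r x * r₁ x)) = 0 := by
    rw [integral_eq_sub_of_hasDerivWithinAt_unit
      (u := fun x => f x * ((u x) ^ 2 + (r x) ^ 2)) (fun x hx => ?_) (by fun_prop) h1, hf0, hf1]
    · simp
    · have := (hf x hx).mul (((hu x hx).pow 2).add ((hr x hx).pow 2))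
      refine this.congr_deriv ?_
      simp only [Pi.add_apply, Pi.pow_apply]
      push_cast
      ring
  have hwE : ∀ x ∈ Icc (0 : ℝ) 1, (w x) ^ 2 ≤ E := fun x hx =>
    (sq_le_integral_sq hw cu hw0 hx).trans
      (integral_mono_unit (by fun_prop) cE fun y _ => by nlinarith [sq_nonneg (r y)])
  have hpt : ∀ x ∈ Icc (0 : ℝ) 1,
      2 * u x * (-f x * u₁ x - w x * G x + s x * u x - r x + J)
        + 2 * r x * (r x * f₁ x + σ x * u x - f x * r₁ x - w x * σ₁ x)
      ≤ 2 * J * u x - (f₁ x * ((u x) ^ 2 + (r x) ^ 2)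
          + f x * (2 * u x * u₁ x + 2 * r x * r₁ x))
        + ((10 * K + 1) * ((u x) ^ 2 + (r x) ^ 2) + 2 * K * E) := by
    intro x hx
    obtain ⟨a1, a2⟩ := abs_le.1 (bf₁ x hx)
    -- Young's inequality with a bounded coefficient, applied to each mixed product.
    have prod : ∀ p q c : ℝ, |c| ≤ K → 2 * (p * q * c) ≤ K * (p ^ 2 + q ^ 2) := by
      intro p q c hc
      obtain ⟨b1, b2⟩ := abs_le.1 hc
      nlinarith [mul_nonneg (sub_nonneg.2 b2) (sq_nonneg (p + q)),
        mul_nonneg (neg_le_iff_add_nonneg.1 b1) (sq_nonneg (p - q))]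
    have p1 := prod (-w x) (u x) (G x) (bG x hx)
    have p2 := prod (u x) (r x) (σ x) (bσ x hx)
    have p3 := prod (-w x) (r x) (σ₁ x) (bσ₁ x hx)
    have p4 : s x * (u x) ^ 2 ≤ 2 * K * (u x) ^ 2 :=
      mul_le_mul_of_nonneg_right (abs_le.1 (bs x hx)).2 (sq_nonneg _)
    have p5 : f₁ x * (r x) ^ 2 ≤ K * (r x) ^ 2 := mul_le_mul_of_nonneg_right a2 (sq_nonneg _)
    have p6 : f₁ x * (u x) ^ 2 ≤ K * (u x) ^ 2 := mul_le_mul_of_nonneg_right a2 (sq_nonneg _)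
    have p7 := mul_le_mul_of_nonneg_left (hwE x hx) hK
    have p8 := mul_nonneg hK (sq_nonneg (r x))
    nlinarith [sq_nonneg (u x + r x)]
  refine (integral_mono_unit (by fun_prop) (by fun_prop) hpt).trans_eq ?_
  have ii : ∀ {k : ℝ → ℝ}, ContinuousOn k (Icc 0 1) → IntervalIntegrable k volume 0 1 :=
    fun hk => intervalIntegrable_of_continuousOn_unit hk h1
  have hlast : ∫ x in (0 : ℝ)..1, ((10 * K + 1) * ((u x) ^ 2 + (r x) ^ 2) + 2 * K * E)
      = (10 * K + 1) * E + 2 * K * E := by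
    rw [intervalIntegral.integral_add (ii (by fun_prop)) (ii (by fun_prop)),
      intervalIntegral.integral_const_mul, ← hE, intervalIntegral.integral_const]
    simp
  rw [intervalIntegral.integral_add (ii (by fun_prop)) (ii (by fun_prop)),
    intervalIntegral.integral_sub (ii (by fun_prop)) (ii (by fun_prop)),
    intervalIntegral.integral_const_mul, hIJ, hdiv, hlast]
  ring

/-- Grönwall: `E(s) exp(-C s)` is nonincreasing and starts from `0`. -/
theorem eq_zero_of_deriv_le_mul {a b C : ℝ} {E E' : ℝ → ℝ} (hc : ContinuousOn E (Icc a b))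
    (hd : ∀ t ∈ Ioo a b, HasDerivAt E (E' t) t) (hle : ∀ t ∈ Ioo a b, E' t ≤ C * E t)
    (h0 : E a = 0) (hnn : ∀ t ∈ Icc a b, 0 ≤ E t) : ∀ t ∈ Icc a b, E t = 0 := by
  intro t ht
  have hanti : AntitoneOn (fun s => E s * Real.exp (-C * s)) (Icc a b) := by
    have hder : ∀ s ∈ Ioo a b, HasDerivAt (fun s => E s * Real.exp (-C * s))
        (E' s * Real.exp (-C * s) + E s * (Real.exp (-C * s) * (-C))) s := fun s hs => by
      have h2 : HasDerivAt (fun s : ℝ => -C * s) (-C) s := by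
        simpa using (hasDerivAt_id s).const_mul (-C)
      exact (hd s hs).mul h2.exp
    refine antitoneOn_of_deriv_nonpos (convex_Icc a b) (by fun_prop) ?_ ?_
    · intro s hs
      rw [interior_Icc] at hs
      exact (hder s hs).differentiableAt.differentiableWithinAt
    · intro s hs
      rw [interior_Icc] at hs
      rw [(hder s hs).deriv]
      nlinarith [hle s hs, Real.exp_pos (-C * s),
        mul_nonneg (sub_nonneg.2 (hle s hs)) (Real.exp_pos (-C * s)).le]
  have h1 := hanti (left_mem_Icc.2 (ht.1.trans ht.2)) ht ht.1
  simp only [h0, zero_mul] at h1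
  exact le_antisymm (nonpos_of_mul_nonpos_left h1 (Real.exp_pos _)) (hnn t ht)

namespace IsDirichletSolution

variable {f₀ ρ₀ : ℝ → ℝ} {T : ℝ} {f ρ g σ : ℝ → ℝ → ℝ}

theorem hasDeriv_f (h : IsDirichletSolution f₀ ρ₀ T f ρ) {t : ℝ} (ht : t ∈ Ico 0 T) :
    ∀ x ∈ Icc (0 : ℝ) 1, HasDerivWithinAt (f t) (dX (f t) x) (Icc 0 1) x :=
  fun x hx => (h.diff_f t ht x hx).hasDerivWithinAt

theorem hasDeriv_fx (h : IsDirichletSolution f₀ ρ₀ T f ρ) {t : ℝ} (ht : t ∈ Ico 0 T) :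
    ∀ x ∈ Icc (0 : ℝ) 1, HasDerivWithinAt (dX (f t)) (dX (dX (f t)) x) (Icc 0 1) x :=
  fun x hx => (h.diff_fx t ht x hx).hasDerivWithinAt

theorem hasDeriv_rho (h : IsDirichletSolution f₀ ρ₀ T f ρ) {t : ℝ} (ht : t ∈ Ico 0 T) :
    ∀ x ∈ Icc (0 : ℝ) 1, HasDerivWithinAt (ρ t) (dX (ρ t) x) (Icc 0 1) x :=
  fun x hx => (h.diff_rho t ht x hx).hasDerivWithinAt

theorem hasDerivAt_fx (h : IsDirichletSolution f₀ ρ₀ T f ρ) {t : ℝ} (ht : t ∈ Ioo 0 T) {x : ℝ}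
    (hx : x ∈ Icc (0 : ℝ) 1) :
    HasDerivAt (fun s => dX (f s) x)
      (nonlocalI (f t) (ρ t) - f t x * dX (dX (f t)) x + (dX (f t) x) ^ 2 - ρ t x) t := by
  have e := h.eq_f t ht x hx
  exact (h.diff_t_fx t ht x hx).hasDerivAt.congr_deriv (by linarith)

theorem hasDerivAt_rho (h : IsDirichletSolution f₀ ρ₀ T f ρ) {t : ℝ} (ht : t ∈ Ioo 0 T) {x : ℝ}
    (hx : x ∈ Icc (0 : ℝ) 1) :
    HasDerivAt (fun s => ρ s x) (ρ t x * dX (f t) x - f t x * dX (ρ t) x) t := by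
  have e := h.eq_rho t ht x hx
  exact (h.diff_t_rho t ht x hx).hasDerivAt.congr_deriv (by linarith)

theorem continuousOn_nonlocalI (h : IsDirichletSolution f₀ ρ₀ T f ρ) :
    ContinuousOn (fun t => nonlocalI (f t) (ρ t)) (Ico 0 T) :=
  (continuousOn_integral_unit h.cont_rho).sub
    ((continuousOn_integral_unit (h := fun t x => (dX (f t) x) ^ 2)
      (h.cont_fx.pow 2)).const_mul 2)

/-- Two classical solutions with the same data coincide. -/
theorem unique (h : IsDirichletSolution f₀ ρ₀ T f ρ) (k : IsDirichletSolution f₀ ρ₀ T g σ) :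
    ∀ t ∈ Ico 0 T, ∀ x ∈ Icc (0 : ℝ) 1, f t x = g t x ∧ ρ t x = σ t x := by
  intro t₁ ht₁
  have hsub : Icc 0 t₁ ⊆ Ico 0 T := fun s hs => ⟨hs.1, hs.2.trans_lt ht₁.2⟩
  have hsub' : Ioo 0 T ⊆ Ico 0 T := Ioo_subset_Ico_self
  have bound : ∀ {q : ℝ → ℝ → ℝ},
      ContinuousOn (fun p : ℝ × ℝ => q p.1 p.2) (Ico 0 T ×ˢ Icc 0 1) →
      ∃ K, ∀ t ∈ Icc 0 t₁, ∀ x ∈ Icc (0 : ℝ) 1, |q t x| ≤ K := by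
    intro q hq
    obtain ⟨K, hK⟩ := (isCompact_Icc.prod isCompact_Icc).exists_bound_of_continuousOn
      (hq.mono (prod_mono_left (t := Icc (0 : ℝ) 1) hsub))
    exact ⟨K, fun t ht x hx => hK (t, x) ⟨ht, hx⟩⟩
  obtain ⟨K₁, hK₁⟩ := bound (q := fun t => dX (f t)) h.cont_fx
  obtain ⟨K₂, hK₂⟩ := bound (q := fun t => dX (g t)) k.cont_fx
  obtain ⟨K₃, hK₃⟩ := bound (q := fun t => dX (dX (g t))) k.cont_fxx
  obtain ⟨K₄, hK₄⟩ := bound k.cont_rho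
  obtain ⟨K₅, hK₅⟩ := bound (q := fun t => dX (σ t)) k.cont_rhox
  obtain ⟨K, l₁, l₂, l₃, l₄, l₅⟩ : ∃ K, K₁ ≤ K ∧ K₂ ≤ K ∧ K₃ ≤ K ∧ K₄ ≤ K ∧ K₅ ≤ K :=
    ⟨max K₁ (max K₂ (max K₃ (max K₄ K₅))), by simp⟩
  have cf := h.cont_f
  have cfx := h.cont_fx
  have cfxx := h.cont_fxx
  have cr := h.cont_rho
  have crx := h.cont_rhox
  have cg := k.cont_f
  have cgx := k.cont_fx
  have cgxx := k.cont_fxx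
  have cs := k.cont_rho
  have csx := k.cont_rhox
  have cE : ContinuousOn (fun p : ℝ × ℝ => (dX (f p.1) p.2 - dX (g p.1) p.2) ^ 2
      + (ρ p.1 p.2 - σ p.1 p.2) ^ 2) (Ico 0 T ×ˢ Icc 0 1) := by fun_prop
  set E : ℝ → ℝ := fun t => ∫ x in (0 : ℝ)..1, ((dX (f t) x - dX (g t) x) ^ 2
      + (ρ t x - σ t x) ^ 2) with hE
  have cEi : ContinuousOn E (Ico 0 T) := continuousOn_integral_unit
    (h := fun t x => (dX (f t) x - dX (g t) x) ^ 2 + (ρ t x - σ t x) ^ 2) cE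
  have cJ : ContinuousOn (fun p : ℝ × ℝ => nonlocalI (f p.1) (ρ p.1) - nonlocalI (g p.1) (σ p.1))
      (Ico 0 T ×ˢ Icc 0 1) :=
    (h.continuousOn_nonlocalI.sub k.continuousOn_nonlocalI).comp
      (f := fun p : ℝ × ℝ => p.1) continuousOn_fst fun p hp => hp.1
  -- The time derivative of the energy density, with products split as in `f f_xx - g g_xx = f (f_xx
  -- - g_xx) + (f - g) g_xx`, so that it has the shape required by `energy_production_le`.
  set P : ℝ → ℝ → ℝ := fun t x =>
    2 * (dX (f t) x - dX (g t) x) * (-f t x * (dX (dX (f t)) x - dX (dX (g t)) x)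
      - (f t x - g t x) * dX (dX (g t)) x
      + (dX (f t) x + dX (g t) x) * (dX (f t) x - dX (g t) x) - (ρ t x - σ t x)
      + (nonlocalI (f t) (ρ t) - nonlocalI (g t) (σ t)))
    + 2 * (ρ t x - σ t x) * ((ρ t x - σ t x) * dX (f t) x + σ t x * (dX (f t) x - dX (g t) x)
      - f t x * (dX (ρ t) x - dX (σ t) x) - (f t x - g t x) * dX (σ t) x) with hP
  have cP : ContinuousOn (fun p : ℝ × ℝ => P p.1 p.2) (Ico 0 T ×ˢ Icc 0 1) := by
    simp only [hP]
    fun_prop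
  have hder : ∀ t ∈ Ioo 0 T, HasDerivAt E (∫ x in (0 : ℝ)..1, P t x) t := by
    intro t ht
    refine hasDerivAt_integral_of_continuousOn
      (h := fun t x => (dX (f t) x - dX (g t) x) ^ 2 + (ρ t x - σ t x) ^ 2)
      (cE.mono (prod_mono_left hsub')) (cP.mono (prod_mono_left hsub')) ?_ ht
      (right_mem_Icc.2 zero_le_one)
    intro s hs x hx
    have := (((h.hasDerivAt_fx hs hx).sub (k.hasDerivAt_fx hs hx)).pow 2).add
      (((h.hasDerivAt_rho hs hx).sub (k.hasDerivAt_rho hs hx)).pow 2)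
    refine this.congr_deriv ?_
    simp only [hP, Pi.sub_apply]
    push_cast
    ring
  have hzero : ∀ t ∈ Icc 0 t₁, E t = 0 := by
    refine eq_zero_of_deriv_le_mul (C := 12 * K + 1) (cEi.mono hsub)
      (fun t ht => hder t ⟨ht.1, ht.2.trans ht₁.2⟩) ?_ ?_ ?_
    · intro t ht
      have htI := Ioo_subset_Icc_self ht
      have htT := hsub htI
      refine energy_production_le (h.hasDeriv_f htT)
        (fun x hx => (h.hasDeriv_fx htT x hx).sub (k.hasDeriv_fx htT x hx))
        (fun x hx => (h.hasDeriv_rho htT x hx).sub (k.hasDeriv_rho htT x hx))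
        (fun x hx => (h.hasDeriv_f htT x hx).sub (k.hasDeriv_f htT x hx))
        (continuousOn_slice (h := fun t => dX (f t)) cfx htT)
        ((continuousOn_slice (h := fun t => dX (dX (f t))) cfxx htT).sub
          (continuousOn_slice (h := fun t => dX (dX (g t))) cgxx htT))
        ((continuousOn_slice (h := fun t => dX (ρ t)) crx htT).sub
          (continuousOn_slice (h := fun t => dX (σ t)) csx htT))
        (continuousOn_slice (h := fun t => dX (dX (g t))) cgxx htT)
        (continuousOn_slice cs htT)
        (continuousOn_slice (h := fun t => dX (σ t)) csx htT)
        ((continuousOn_slice (h := fun t => dX (f t)) cfx htT).add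
          (continuousOn_slice (h := fun t => dX (g t)) cgx htT))
        (h.bdry_f t htT).1 (h.bdry_f t htT).2 ?_ ?_
        (fun x hx => (hK₁ t htI x hx).trans l₁) (fun x hx => (hK₃ t htI x hx).trans l₃)
        (fun x hx => (hK₄ t htI x hx).trans l₄) (fun x hx => (hK₅ t htI x hx).trans l₅) ?_
      · simp [(h.bdry_f t htT).1, (k.bdry_f t htT).1]
      · simp [(h.bdry_f t htT).2, (k.bdry_f t htT).2]
      · intro x hx
        have e₁ := (hK₁ t htI x hx).trans l₁
        have e₂ := (hK₂ t htI x hx).trans l₂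
        exact (abs_add_le _ _).trans (by linarith)
    · have hf : EqOn (f 0) (g 0) (Icc 0 1) := fun x hx => by rw [h.init_f x hx, k.init_f x hx]
      have hr : EqOn (ρ 0) (σ 0) (Icc 0 1) := fun x hx => by
        rw [h.init_rho x hx, k.init_rho x hx]
      rw [hE]
      refine (intervalIntegral.integral_congr (g := fun _ => 0) fun x hx => ?_).trans (by simp)
      rw [uIcc_of_le zero_le_one] at hx
      simp [dX_congr hf hx, hr hx]
    · intro t _
      exact intervalIntegral.integral_nonneg zero_le_one fun x _ => by positivity
  have h1 : t₁ ∈ Icc 0 t₁ := right_mem_Icc.2 ht₁.1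
  have hpt : ∀ x ∈ Icc (0 : ℝ) 1, (dX (f t₁) x - dX (g t₁) x) ^ 2
      + (ρ t₁ x - σ t₁ x) ^ 2 = 0 := by
    have cEs := continuousOn_slice
      (h := fun t x => (dX (f t) x - dX (g t) x) ^ 2 + (ρ t x - σ t x) ^ 2) cE ht₁
    have hz := hzero t₁ h1
    rw [hE] at hz
    by_contra! hne
    obtain ⟨x, hx, hxne⟩ := hne
    have := intervalIntegral.integral_pos zero_lt_one cEs (fun y _ => by positivity)
      ⟨x, hx, lt_of_le_of_ne (by positivity) (Ne.symm hxne)⟩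
    linarith
  intro x hx
  constructor
  -- `f - g` vanishes at `0` and has zero derivative, so the Poincaré inequality with `u = 0` gives
  -- `f = g`.
  · have hw := sq_le_integral_sq (w := fun x => f t₁ x - g t₁ x) (u := fun _ => 0)
      (fun y hy => ?_) (by fun_prop) (by simp [(h.bdry_f t₁ ht₁).1, (k.bdry_f t₁ ht₁).1]) hx
    · simp only [ne_eq, OfNat.ofNat_ne_zero, not_false_eq_true, zero_pow,
        intervalIntegral.integral_zero] at hw
      have := pow_eq_zero_iff (two_ne_zero) |>.1 (le_antisymm hw (sq_nonneg _))
      linarith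
    · have e := hpt y hy
      exact ((h.hasDeriv_f ht₁ y hy).sub (k.hasDeriv_f ht₁ y hy)).congr_deriv
        (by nlinarith [sq_nonneg (ρ t₁ y - σ t₁ y)])
  · nlinarith [hpt x hx, sq_nonneg (dX (f t₁) x - dX (g t₁) x)]

theorem mono (h : IsDirichletSolution f₀ ρ₀ T f ρ) {T' : ℝ} (hT : T' ≤ T) :
    IsDirichletSolution f₀ ρ₀ T' f ρ := by
  have h1 : Ico 0 T' ⊆ Ico 0 T := Ico_subset_Ico_right hT
  have h2 : Ioo 0 T' ⊆ Ioo 0 T := Ioo_subset_Ioo_right hT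
  have h3 : Ico 0 T' ×ˢ Icc (0 : ℝ) 1 ⊆ Ico 0 T ×ˢ Icc 0 1 := prod_mono_left h1
  exact ⟨fun t ht => h.diff_f t (h1 ht), fun t ht => h.diff_fx t (h1 ht),
    fun t ht => h.diff_rho t (h1 ht), h.cont_f.mono h3, h.cont_fx.mono h3, h.cont_fxx.mono h3,
    h.cont_rho.mono h3, h.cont_rhox.mono h3, fun t ht => h.diff_t_fx t (h2 ht),
    fun t ht => h.diff_t_rho t (h2 ht), fun t ht => h.eq_f t (h2 ht),
    fun t ht => h.eq_rho t (h2 ht), h.init_f, h.init_rho, fun t ht => h.bdry_f t (h1 ht),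
    fun t ht => h.bdry_rho t (h1 ht)⟩

/-- A solution along which `∫ f_x` blows up at some point cannot be continued. -/
theorem le_of_blowup (h : IsDirichletSolution f₀ ρ₀ T f ρ) (hT : 0 < T) {x : ℝ}
    (hx : x ∈ Icc (0 : ℝ) 1)
    (hblow : Tendsto (fun t : ℝ => ∫ s in (0 : ℝ)..t, dX (f s) x) (𝓝[<] T) atTop)
    {T' : ℝ} (k : IsDirichletSolution f₀ ρ₀ T' g σ) : T' ≤ T := by
  by_contra! hlt
  have hu := h.unique (k.mono hlt.le)
  have hsub : Icc 0 T ⊆ Ico 0 T' := fun s hs => ⟨hs.1, hs.2.trans_lt hlt⟩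
  have hc : ContinuousOn (fun s => dX (g s) x) (Icc 0 T) :=
    (continuousOn_slice_left (h := fun s => dX (g s)) k.cont_fx hx).mono hsub
  obtain ⟨K, hK⟩ := isCompact_Icc.exists_bound_of_continuousOn hc
  -- A solution beyond `T` has `f_x` bounded on `[0,T]` at the point `x`, so the integral in
  -- question cannot exceed `K T`.
  have hb : ∀ᶠ t in 𝓝[<] T, ∫ s in (0 : ℝ)..t, dX (f s) x ≤ K * T := by
    filter_upwards [Ioo_mem_nhdsLT hT] with t ht
    have hKn : 0 ≤ K := (norm_nonneg _).trans (hK 0 (left_mem_Icc.2 hT.le))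
    have h1 := intervalIntegral.norm_integral_le_of_norm_le_const (a := (0 : ℝ)) (b := t)
      (f := fun s => dX (f s) x) (C := K) (fun s hs => ?_)
    · refine (le_abs_self _).trans (h1.trans ?_)
      rw [sub_zero, abs_of_pos ht.1]
      exact mul_le_mul_of_nonneg_left ht.2.le hKn
    · rw [uIoc_of_le ht.1.le] at hs
      have hsT : s ∈ Ico 0 T := ⟨hs.1.le, hs.2.trans_lt ht.2⟩
      rw [dX_congr (fun y hy => (hu s hsT y hy).1) hx]
      exact hK s (Ico_subset_Icc_self hsT)
  obtain ⟨t, ht1, ht2⟩ := (hb.and (hblow.eventually_gt_atTop (K * T))).exists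
  linarith

end IsDirichletSolution

/-! ### Flow of the interval and its inverse. -/

theorem hasDerivWithinAt_integral_unit {h : ℝ → ℝ} (hh : ContinuousOn h (Icc 0 1)) {x : ℝ}
    (hx : x ∈ Icc (0 : ℝ) 1) :
    HasDerivWithinAt (fun c => ∫ z in (0 : ℝ)..c, h z) (h x) (Icc 0 1) x := by
  have hc : Continuous fun z : ℝ => h (projIcc (0 : ℝ) 1 zero_le_one z) :=
    hh.comp_continuous (continuous_subtype_val.comp continuous_projIcc)
      fun z => (projIcc (0 : ℝ) 1 zero_le_one z).2
  have hproj : ∀ z ∈ Icc (0 : ℝ) 1, h (projIcc (0 : ℝ) 1 zero_le_one z) = h z := fun z hz => by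
    rw [projIcc_of_mem zero_le_one hz]
  have heq : ∀ c ∈ Icc (0 : ℝ) 1, ∫ z in (0 : ℝ)..c, h z
      = ∫ z in (0 : ℝ)..c, h (projIcc (0 : ℝ) 1 zero_le_one z) := fun c hc =>
    intervalIntegral.integral_congr fun z hz => (hproj z (uIcc_subset_unit hc hz)).symm
  refine ((hc.integral_hasStrictDerivAt 0 x).hasDerivAt.hasDerivWithinAt.congr heq
    (heq x hx)).congr_deriv (hproj x hx)

/-- The slope of `f` is `k` times the slope of `h`. Combined with a mean value identity, this
differentiates an inverse function also at endpoints of the interval, with only a limit of `k`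
needed. -/
theorem hasDerivWithinAt_of_sub_eq_mul {f h k : ℝ → ℝ} {s : Set ℝ} {z₀ k₀ h' : ℝ}
    (heq : ∀ z ∈ s, f z - f z₀ = k z * (h z - h z₀)) (hk : Tendsto k (𝓝[s] z₀) (𝓝 k₀))
    (hh : HasDerivWithinAt h h' s z₀) : HasDerivWithinAt f (k₀ * h') s z₀ := by
  rw [hasDerivWithinAt_iff_tendsto_slope] at hh ⊢
  have hk' := hk.mono_left (nhdsWithin_mono z₀ (sdiff_subset (s := s) (t := {z₀})))
  refine (hk'.mul hh).congr' ?_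
  filter_upwards [self_mem_nhdsWithin] with z hz
  rw [slope_def_field, slope_def_field, heq z hz.1, mul_div_assoc]

theorem tendsto_of_mem_uIcc {α : Type*} {l : Filter α} {X ξ : α → ℝ} {a : ℝ}
    (hX : Tendsto X l (𝓝 a)) (h : ∀ᶠ z in l, ξ z ∈ uIcc a (X z)) : Tendsto ξ l (𝓝 a) := by
  have h1 := (tendsto_const_nhds (x := a)).min hX
  have h2 := (tendsto_const_nhds (x := a)).max hX
  rw [min_self] at h1
  rw [max_self] at h2
  exact tendsto_of_tendsto_of_tendsto_of_le_of_le' h1 h2 (h.mono fun z hz => hz.1)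
    (h.mono fun z hz => hz.2)

/-- The inverse of the flow `γ(t,x) = ∫₀ˣ 1 / W(t,z) dz` of `[0,1]`. -/
theorem exists_inverse_flow {T : ℝ} {W W₁ : ℝ → ℝ → ℝ}
    (cW : ContinuousOn (fun p : ℝ × ℝ => W p.1 p.2) (Ico 0 T ×ˢ Icc 0 1))
    (cW₁ : ContinuousOn (fun p : ℝ × ℝ => W₁ p.1 p.2) (Ico 0 T ×ˢ Icc 0 1))
    (dW : ∀ t ∈ Ioo 0 T, ∀ x ∈ Icc (0 : ℝ) 1, HasDerivAt (fun s => W s x) (W₁ t x) t)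
    (hpos : ∀ t ∈ Ico 0 T, ∀ x ∈ Icc (0 : ℝ) 1, 0 < W t x)
    (hmass : ∀ t ∈ Ico 0 T, ∫ x in (0 : ℝ)..1, 1 / W t x = 1) :
    ∃ X : ℝ → ℝ → ℝ, (∀ t ∈ Ico 0 T, ∀ y ∈ Icc (0 : ℝ) 1, X t y ∈ Icc (0 : ℝ) 1) ∧
      (∀ t ∈ Ico 0 T, ∀ x ∈ Icc (0 : ℝ) 1, (∫ z in (0 : ℝ)..x, 1 / W t z) ∈ Icc (0 : ℝ) 1 ∧
        X t (∫ z in (0 : ℝ)..x, 1 / W t z) = x) ∧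
      ContinuousOn (fun p : ℝ × ℝ => X p.1 p.2) (Ico 0 T ×ˢ Icc 0 1) ∧
      (∀ t ∈ Ico 0 T, ∀ y ∈ Icc (0 : ℝ) 1,
        HasDerivWithinAt (X t) (W t (X t y)) (Icc 0 1) y) ∧
      ∀ t ∈ Ioo 0 T, ∀ y ∈ Icc (0 : ℝ) 1, HasDerivAt (fun s => X s y)
        (W t (X t y) * ∫ z in (0 : ℝ)..X t y, W₁ t z / (W t z) ^ 2) t := by
  have h01 : (1 : ℝ) ∈ Icc (0 : ℝ) 1 := right_mem_Icc.2 zero_le_one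
  have h00 : (0 : ℝ) ∈ Icc (0 : ℝ) 1 := left_mem_Icc.2 zero_le_one
  have hsub : Ioo 0 T ⊆ Ico 0 T := Ioo_subset_Ico_self
  have hne : ∀ p ∈ Ico 0 T ×ˢ Icc (0 : ℝ) 1, W p.1 p.2 ≠ 0 := fun p hp =>
    (hpos p.1 hp.1 p.2 hp.2).ne'
  have cinv : ContinuousOn (fun p : ℝ × ℝ => 1 / W p.1 p.2) (Ico 0 T ×ˢ Icc 0 1) :=
    continuousOn_const.div cW hne
  set γ : ℝ → ℝ → ℝ := fun t x => ∫ z in (0 : ℝ)..x, 1 / W t z with hγ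
  have cγ : ContinuousOn (fun p : ℝ × ℝ => γ p.1 p.2) (Ico 0 T ×ˢ Icc 0 1) :=
    continuousOn_integral_joint (h := fun t x => 1 / W t x) cinv
  have dγ : ∀ t ∈ Ico 0 T, ∀ x ∈ Icc (0 : ℝ) 1,
      HasDerivWithinAt (γ t) (1 / W t x) (Icc 0 1) x := fun t ht x hx =>
    hasDerivWithinAt_integral_unit (continuousOn_slice (h := fun t x => 1 / W t x) cinv ht) hx
  have hγ0 : ∀ t, γ t 0 = 0 := fun t => by simp [hγ]
  have hγ1 : ∀ t ∈ Ico 0 T, γ t 1 = 1 := hmass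
  have hlt : ∀ t ∈ Ico 0 T, ∀ x₁ ∈ Icc (0 : ℝ) 1, ∀ x₂ ∈ Icc (0 : ℝ) 1, x₁ < x₂ →
      ∃ ξ ∈ Ioo x₁ x₂, x₂ - x₁ = W t ξ * (γ t x₂ - γ t x₁) := by
    intro t ht x₁ h₁ x₂ h₂ hlt
    have hs : Icc x₁ x₂ ⊆ Icc 0 1 := Icc_subset_Icc h₁.1 h₂.2
    obtain ⟨ξ, hξ, e⟩ := exists_hasDerivAt_eq_slope (γ t) (fun x => 1 / W t x) hlt
      (fun x hx => ((dγ t ht x (hs hx)).continuousWithinAt).mono hs)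
      (fun x hx => (dγ t ht x (hs (Ioo_subset_Icc_self hx))).hasDerivAt
        (Icc_mem_nhds (h₁.1.trans_lt hx.1) (hx.2.trans_le h₂.2)))
    refine ⟨ξ, hξ, ?_⟩
    have hW := hpos t ht ξ (hs (Ioo_subset_Icc_self hξ))
    have hx : 0 < x₂ - x₁ := sub_pos.2 hlt
    field_simp at e
    linarith
  have hmono : ∀ t ∈ Ico 0 T, StrictMonoOn (γ t) (Icc 0 1) := by
    intro t ht x₁ h₁ x₂ h₂ h12
    obtain ⟨ξ, hξ, e⟩ := hlt t ht x₁ h₁ x₂ h₂ h12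
    have hW := hpos t ht ξ ⟨h₁.1.trans hξ.1.le, hξ.2.le.trans h₂.2⟩
    have : 0 < W t ξ * (γ t x₂ - γ t x₁) := by rw [← e]; exact sub_pos.2 h12
    exact sub_pos.1 (pos_of_mul_pos_right this hW.le)
  have hmv : ∀ t ∈ Ico 0 T, ∀ x₁ ∈ Icc (0 : ℝ) 1, ∀ x₂ ∈ Icc (0 : ℝ) 1,
      ∃ ξ ∈ uIcc x₁ x₂, x₂ - x₁ = W t ξ * (γ t x₂ - γ t x₁) := by
    intro t ht x₁ h₁ x₂ h₂
    rcases lt_trichotomy x₁ x₂ with h | h | h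
    · obtain ⟨ξ, hξ, e⟩ := hlt t ht x₁ h₁ x₂ h₂ h
      exact ⟨ξ, Icc_subset_uIcc (Ioo_subset_Icc_self hξ), e⟩
    · exact ⟨x₁, left_mem_uIcc, by simp [h]⟩
    · obtain ⟨ξ, hξ, e⟩ := hlt t ht x₂ h₂ x₁ h₁ h
      exact ⟨ξ, Icc_subset_uIcc' (Ioo_subset_Icc_self hξ), by linarith⟩
  have hsurj : ∀ t ∈ Ico 0 T, ∀ y ∈ Icc (0 : ℝ) 1, ∃ x ∈ Icc (0 : ℝ) 1, γ t x = y := by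
    intro t ht y hy
    have := intermediate_value_Icc zero_le_one
      (fun x hx => (dγ t ht x hx).continuousWithinAt : ContinuousOn (γ t) (Icc 0 1))
    rw [hγ0, hγ1 t ht] at this
    exact this hy
  choose! X hXm hXe using hsurj
  have hγm : ∀ t ∈ Ico 0 T, ∀ x ∈ Icc (0 : ℝ) 1, γ t x ∈ Icc (0 : ℝ) 1 := by
    intro t ht x hx
    have h1 := (hmono t ht).monotoneOn h00 hx hx.1
    have h2 := (hmono t ht).monotoneOn hx h01 hx.2
    rw [hγ0] at h1
    rw [hγ1 t ht] at h2
    exact ⟨h1, h2⟩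
  have hleft : ∀ t ∈ Ico 0 T, ∀ x ∈ Icc (0 : ℝ) 1, X t (γ t x) = x := fun t ht x hx =>
    (hmono t ht).injOn (hXm t ht _ (hγm t ht x hx)) hx (hXe t ht _ (hγm t ht x hx))
  -- This mean value identity for the inverse flow carries the rest: it yields joint continuity, and
  -- with `x₀ = X t y` both the derivative in `y` and the one in `t`.
  have hdiff : ∀ x₀ ∈ Icc (0 : ℝ) 1, ∀ t ∈ Ico 0 T, ∀ y ∈ Icc (0 : ℝ) 1,
      ∃ ξ ∈ uIcc x₀ (X t y), X t y - x₀ = W t ξ * (y - γ t x₀) := by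
    intro x₀ hx₀ t ht y hy
    obtain ⟨ξ, hξ, e⟩ := hmv t ht x₀ hx₀ (X t y) (hXm t ht y hy)
    rw [hXe t ht y hy] at e
    exact ⟨ξ, hξ, e⟩
  have cX : ContinuousOn (fun p : ℝ × ℝ => X p.1 p.2) (Ico 0 T ×ˢ Icc 0 1) := by
    rintro ⟨t₀, y₀⟩ ⟨ht₀, hy₀⟩
    simp only at ht₀ hy₀
    set x₀ := X t₀ y₀ with hx₀
    have hx₀m : x₀ ∈ Icc (0 : ℝ) 1 := hXm t₀ ht₀ y₀ hy₀
    obtain ⟨t₁, ht₀₁, ht₁⟩ := exists_between ht₀.2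
    have hs : Icc 0 t₁ ⊆ Ico 0 T := fun s hs => ⟨hs.1, hs.2.trans_lt ht₁⟩
    -- With `W` bounded by `K` up to time `t₁`, the identity gives `|X t y - x₀| ≤ K |y - γ t x₀|`,
    -- whose right side is continuous and vanishes at the base point.
    obtain ⟨K, hK⟩ := (isCompact_Icc.prod isCompact_Icc).exists_bound_of_continuousOn
      (cW.mono (prod_mono_left (t := Icc (0 : ℝ) 1) hs))
    have hlim : Tendsto (fun p : ℝ × ℝ => K * |p.2 - γ p.1 x₀|)
        (𝓝[Ico 0 T ×ˢ Icc 0 1] (t₀, y₀)) (𝓝 0) := by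
      have h1 : ContinuousWithinAt (fun p : ℝ × ℝ => K * |p.2 - γ p.1 x₀|)
          (Ico 0 T ×ˢ Icc 0 1) (t₀, y₀) := by
        have := (continuousOn_slice_left (h := γ) cγ hx₀m).comp (f := fun p : ℝ × ℝ => p.1)
          (s := Ico 0 T ×ˢ Icc (0 : ℝ) 1) continuousOn_fst fun p hp => hp.1
        exact (continuousOn_const.mul (continuousOn_snd.sub this).abs) _ ⟨ht₀, hy₀⟩
      have h2 := h1.tendsto
      simpa [hXe t₀ ht₀ y₀ hy₀, hx₀] using h2
    refine tendsto_iff_norm_sub_tendsto_zero.2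
      (squeeze_zero' (Eventually.of_forall fun _ => norm_nonneg _) ?_ hlim)
    have hev : ∀ᶠ p : ℝ × ℝ in 𝓝[Ico 0 T ×ˢ Icc 0 1] (t₀, y₀), p.1 < t₁ :=
      nhdsWithin_le_nhds (continuousAt_fst.eventually (gt_mem_nhds ht₀₁))
    filter_upwards [hev, self_mem_nhdsWithin] with p hp1 hp
    obtain ⟨ξ, hξ, e⟩ := hdiff x₀ hx₀m p.1 hp.1 p.2 hp.2
    have hξm : ξ ∈ Icc (0 : ℝ) 1 :=
      ordConnected_Icc.uIcc_subset hx₀m (hXm p.1 hp.1 p.2 hp.2) hξ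
    rw [e, norm_mul]
    exact mul_le_mul_of_nonneg_right (hK (p.1, ξ) ⟨⟨hp.1.1, hp1.le⟩, hξm⟩) (norm_nonneg _)
  refine ⟨X, hXm, fun t ht x hx => ⟨hγm t ht x hx, hleft t ht x hx⟩, cX, ?_, ?_⟩
  · intro t ht y hy
    have hx₀m := hXm t ht y hy
    choose! ξ hξ e using hdiff (X t y) hx₀m t ht
    have hlim : Tendsto ξ (𝓝[Icc 0 1] y) (𝓝 (X t y)) := by
      have hX : Tendsto (X t) (𝓝[Icc 0 1] y) (𝓝 (X t y)) := continuousOn_slice cX ht y hy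
      refine tendsto_of_mem_uIcc hX ?_
      filter_upwards [self_mem_nhdsWithin] with z hz using hξ z hz
    have hWlim : Tendsto (fun z => W t (ξ z)) (𝓝[Icc 0 1] y) (𝓝 (W t (X t y))) := by
      refine (continuousOn_slice cW ht _ hx₀m).tendsto.comp
        (tendsto_nhdsWithin_iff.2 ⟨hlim, ?_⟩)
      filter_upwards [self_mem_nhdsWithin] with z hz using
        ordConnected_Icc.uIcc_subset hx₀m (hXm t ht z hz) (hξ z hz)
    refine (hasDerivWithinAt_of_sub_eq_mul (h := id) (fun z hz => ?_) hWlim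
      (hasDerivWithinAt_id y _)).congr_deriv (mul_one _)
    rw [e z hz, hXe t ht y hy]
    rfl
  · intro t ht y hy
    have htI := hsub ht
    have hx₀m := hXm t htI y hy
    have hdiff' : ∀ s ∈ Ioo 0 T, ∃ ξ ∈ uIcc (X t y) (X s y),
        X s y - X t y = W s ξ * (y - γ s (X t y)) := fun s hs =>
      hdiff (X t y) hx₀m s (hsub hs) y hy
    choose! ξ hξ e using hdiff'
    have hnhds : Ioo 0 T ∈ 𝓝 t := Ioo_mem_nhds ht.1 ht.2
    have hlim : Tendsto ξ (𝓝 t) (𝓝 (X t y)) := by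
      have hX : Tendsto (fun s => X s y) (𝓝 t) (𝓝 (X t y)) :=
        (continuousOn_slice_left cX hy).continuousAt (Ico_mem_nhds ht.1 ht.2)
      refine tendsto_of_mem_uIcc hX ?_
      filter_upwards [hnhds] with z hz using hξ z hz
    have hWlim : Tendsto (fun s => W s (ξ s)) (𝓝 t) (𝓝 (W t (X t y))) := by
      have h1 : Tendsto (fun s => (s, ξ s)) (𝓝 t) (𝓝[Ico 0 T ×ˢ Icc 0 1] (t, X t y)) := by
        refine tendsto_nhdsWithin_iff.2 ⟨tendsto_id.prodMk_nhds hlim, ?_⟩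
        filter_upwards [hnhds] with s hs using ⟨hsub hs,
          ordConnected_Icc.uIcc_subset hx₀m (hXm s (hsub hs) y hy) (hξ s hs)⟩
      exact (cW (t, X t y) ⟨htI, hx₀m⟩).tendsto.comp h1
    have dγt : HasDerivAt (fun s => γ s (X t y))
        (∫ z in (0 : ℝ)..X t y, -W₁ t z / (W t z) ^ 2) t := by
      refine hasDerivAt_integral_of_continuousOn (h := fun t x => 1 / W t x)
        (h' := fun t x => -W₁ t x / (W t x) ^ 2) (cinv.mono (prod_mono_left hsub))
        ((cW₁.neg.div (cW.pow 2) fun p hp => pow_ne_zero 2 (hne p hp)).mono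
          (prod_mono_left hsub)) (fun s hs x hx => ?_) ht hx₀m
      simpa [one_div] using (dW s hs x hx).fun_inv (hpos s (hsub hs) x hx).ne'
    have key := (hasDerivWithinAt_of_sub_eq_mul (f := fun s => X s y)
      (h := fun s => y - γ s (X t y)) (s := Ioo 0 T) (fun s hs => ?_)
      (hWlim.mono_left nhdsWithin_le_nhds) (dγt.const_sub y).hasDerivWithinAt).hasDerivAt hnhds
    · refine key.congr_deriv ?_
      rw [← intervalIntegral.integral_neg]
      congr 1
      refine intervalIntegral.integral_congr fun z _ => ?_
      ring
    · simp only [e s hs, hXe t htI y hy]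
      ring

/-! ### Lagrangian formulation and return to Eulerian variables. -/

/-- The combination `a + b F(x) + p R(x)` with time-dependent coefficients. -/
def profile (F R A B P : ℝ → ℝ) (t x : ℝ) : ℝ := A t + B t * F x + P t * R x

/-- Coefficients of the reciprocal Jacobian `w = A + B F + P R` of a flow of `[0,1]` that solves
`w_tt + I w = R`, with `w = 1` and `w_t = -F` at `t = 0`. -/
structure IsFlowCoeff (F R : ℝ → ℝ) (T : ℝ) (A B P A₁ B₁ P₁ I : ℝ → ℝ) : Prop where
  cA : ContinuousOn A (Ico 0 T)
  cB : ContinuousOn B (Ico 0 T)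
  cP : ContinuousOn P (Ico 0 T)
  cA₁ : ContinuousOn A₁ (Ico 0 T)
  cB₁ : ContinuousOn B₁ (Ico 0 T)
  cP₁ : ContinuousOn P₁ (Ico 0 T)
  cI : ContinuousOn I (Ioo 0 T)
  dA : ∀ t ∈ Ioo 0 T, HasDerivAt A (A₁ t) t
  dB : ∀ t ∈ Ioo 0 T, HasDerivAt B (B₁ t) t
  dP : ∀ t ∈ Ioo 0 T, HasDerivAt P (P₁ t) t
  dA₁ : ∀ t ∈ Ioo 0 T, HasDerivAt A₁ (-I t * A t) t
  dB₁ : ∀ t ∈ Ioo 0 T, HasDerivAt B₁ (-I t * B t) t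
  dP₁ : ∀ t ∈ Ioo 0 T, HasDerivAt P₁ (1 - I t * P t) t
  A_zero : A 0 = 1
  B_zero : B 0 = 0
  P_zero : P 0 = 0
  A₁_zero : A₁ 0 = 0
  B₁_zero : B₁ 0 = -1
  P₁_zero : P₁ 0 = 0
  pos : ∀ t ∈ Ico 0 T, ∀ x ∈ Icc (0 : ℝ) 1, 0 < profile F R A B P t x
  mass : ∀ t ∈ Ico 0 T, ∫ x in (0 : ℝ)..1, 1 / profile F R A B P t x = 1

theorem continuousOn_profile {F R A B P : ℝ → ℝ} {S : Set ℝ} (cF : ContinuousOn F (Icc 0 1))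
    (cR : ContinuousOn R (Icc 0 1)) (cA : ContinuousOn A S) (cB : ContinuousOn B S)
    (cP : ContinuousOn P S) :
    ContinuousOn (fun p : ℝ × ℝ => profile F R A B P p.1 p.2) (S ×ˢ Icc 0 1) := by
  have c1 : ∀ {k : ℝ → ℝ}, ContinuousOn k S →
      ContinuousOn (fun p : ℝ × ℝ => k p.1) (S ×ˢ Icc (0 : ℝ) 1) := fun hk =>
    hk.comp continuousOn_fst fun p hp => hp.1
  have c2 : ∀ {k : ℝ → ℝ}, ContinuousOn k (Icc 0 1) →
      ContinuousOn (fun p : ℝ × ℝ => k p.2) (S ×ˢ Icc (0 : ℝ) 1) := fun hk =>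
    hk.comp continuousOn_snd fun p hp => hp.2
  exact ((c1 cA).add ((c1 cB).mul (c2 cF))).add ((c1 cP).mul (c2 cR))

theorem hasDerivAt_profile {F R A B P A₁ B₁ P₁ : ℝ → ℝ} {t : ℝ} (dA : HasDerivAt A (A₁ t) t)
    (dB : HasDerivAt B (B₁ t) t) (dP : HasDerivAt P (P₁ t) t) (x : ℝ) :
    HasDerivAt (fun s => profile F R A B P s x) (profile F R A₁ B₁ P₁ t x) t :=
  (dA.add (dB.mul_const (F x))).add (dP.mul_const (R x))

theorem hasDerivWithinAt_profile {F F₁ R R₁ : ℝ → ℝ} {s : Set ℝ} {x : ℝ}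
    (dF : HasDerivWithinAt F (F₁ x) s x) (dR : HasDerivWithinAt R (R₁ x) s x)
    (A B P : ℝ → ℝ) (t : ℝ) :
    HasDerivWithinAt (profile F R A B P t) (B t * F₁ x + P t * R₁ x) s x := by
  exact (((dF.const_mul (B t)).const_add (A t)).add (dR.const_mul (P t)))

theorem hasDerivAt_profile_comp {F F₁ R R₁ A B P A₁ B₁ P₁ Y : ℝ → ℝ} {t Y' : ℝ}
    (dA : HasDerivAt A (A₁ t) t) (dB : HasDerivAt B (B₁ t) t) (dP : HasDerivAt P (P₁ t) t)
    (dF : HasDerivAt (fun s => F (Y s)) (F₁ (Y t) * Y') t)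
    (dR : HasDerivAt (fun s => R (Y s)) (R₁ (Y t) * Y') t) :
    HasDerivAt (fun s => profile F R A B P s (Y s))
      (profile F R A₁ B₁ P₁ t (Y t) + (B t * F₁ (Y t) + P t * R₁ (Y t)) * Y') t := by
  refine ((dA.add (dB.mul dF)).add (dP.mul dR)).congr_deriv ?_
  simp only [profile]
  ring

namespace IsFlowCoeff

variable {F F₁ R R₁ : ℝ → ℝ} {T : ℝ} {A B P A₁ B₁ P₁ I : ℝ → ℝ}

theorem profile_zero (h : IsFlowCoeff F R T A B P A₁ B₁ P₁ I) (x : ℝ) :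
    profile F R A B P 0 x = 1 := by
  simp [profile, h.A_zero, h.B_zero, h.P_zero]

theorem profile₁_zero (h : IsFlowCoeff F R T A B P A₁ B₁ P₁ I) (x : ℝ) :
    profile F R A₁ B₁ P₁ 0 x = -F x := by
  simp [profile, h.A₁_zero, h.B₁_zero, h.P₁_zero]

theorem hasDerivAt_profile₁ (h : IsFlowCoeff F R T A B P A₁ B₁ P₁ I) {t : ℝ}
    (ht : t ∈ Ioo 0 T) (x : ℝ) :
    HasDerivAt (fun s => profile F R A₁ B₁ P₁ s x) (R x - I t * profile F R A B P t x) t := by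
  refine (((h.dA₁ t ht).add ((h.dB₁ t ht).mul_const (F x))).add
    ((h.dP₁ t ht).mul_const (R x))).congr_deriv ?_
  simp only [profile]
  ring

/-- This is the time derivative of the constant mass `∫ 1/w`. It is also the velocity of the
endpoint `1`, so it supplies the boundary condition there. -/
theorem integral_velocity_eq_zero (h : IsFlowCoeff F R T A B P A₁ B₁ P₁ I)
    (cF : ContinuousOn F (Icc 0 1)) (cR : ContinuousOn R (Icc 0 1)) {t : ℝ} (ht : t ∈ Ioo 0 T) :
    ∫ x in (0 : ℝ)..1, -profile F R A₁ B₁ P₁ t x / (profile F R A B P t x) ^ 2 = 0 := by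
  have hsub : Ioo 0 T ⊆ Ico 0 T := Ioo_subset_Ico_self
  have cW := continuousOn_profile cF cR (h.cA.mono hsub) (h.cB.mono hsub) (h.cP.mono hsub)
  have cW₁ := continuousOn_profile cF cR (h.cA₁.mono hsub) (h.cB₁.mono hsub) (h.cP₁.mono hsub)
  have hne : ∀ p ∈ Ioo 0 T ×ˢ Icc (0 : ℝ) 1, profile F R A B P p.1 p.2 ≠ 0 := fun p hp =>
    (h.pos p.1 (hsub hp.1) p.2 hp.2).ne'
  have key := hasDerivAt_integral_of_continuousOn (h := fun t x => 1 / profile F R A B P t x)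
    (h' := fun t x => -profile F R A₁ B₁ P₁ t x / (profile F R A B P t x) ^ 2)
    (continuousOn_const.div cW hne) (cW₁.neg.div (cW.pow 2) fun p hp => pow_ne_zero 2 (hne p hp))
    (fun s hs x hx => by
      simpa [one_div] using (hasDerivAt_profile (F := F) (R := R) (h.dA s hs) (h.dB s hs)
        (h.dP s hs) x).fun_inv (hne (s, x) ⟨hs, hx⟩)) ht (right_mem_Icc.2 zero_le_one)
  refine key.unique ((hasDerivAt_const t (1 : ℝ)).congr_of_eventuallyEq ?_)
  filter_upwards [Ioo_mem_nhds ht.1 ht.2] with s hs using h.mass s (hsub hs)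

/-- The coefficient `I` is determined by the conservation of mass. -/
theorem coeff_eq (h : IsFlowCoeff F R T A B P A₁ B₁ P₁ I)
    (cF : ContinuousOn F (Icc 0 1)) (cR : ContinuousOn R (Icc 0 1)) {t : ℝ} (ht : t ∈ Ioo 0 T) :
    (∫ x in (0 : ℝ)..1, R x / profile F R A B P t x * (1 / profile F R A B P t x))
      - 2 * (∫ x in (0 : ℝ)..1, (-profile F R A₁ B₁ P₁ t x / profile F R A B P t x) ^ 2
        * (1 / profile F R A B P t x)) = I t := by
  have hsub : Ioo 0 T ⊆ Ico 0 T := Ioo_subset_Ico_self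
  have cW := continuousOn_profile cF cR (h.cA.mono hsub) (h.cB.mono hsub) (h.cP.mono hsub)
  have cW₁ := continuousOn_profile cF cR (h.cA₁.mono hsub) (h.cB₁.mono hsub) (h.cP₁.mono hsub)
  have hne : ∀ p ∈ Ioo 0 T ×ˢ Icc (0 : ℝ) 1, profile F R A B P p.1 p.2 ≠ 0 := fun p hp =>
    (h.pos p.1 (hsub hp.1) p.2 hp.2).ne'
  have cI' : ContinuousOn (fun p : ℝ × ℝ => I p.1) (Ioo 0 T ×ˢ Icc (0 : ℝ) 1) :=
    h.cI.comp continuousOn_fst fun p hp => hp.1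
  have cR' : ContinuousOn (fun p : ℝ × ℝ => R p.2) (Ioo 0 T ×ˢ Icc (0 : ℝ) 1) :=
    cR.comp continuousOn_snd fun p hp => hp.2
  have c1 : ContinuousOn (fun p : ℝ × ℝ => R p.2 / profile F R A B P p.1 p.2
      * (1 / profile F R A B P p.1 p.2)) (Ioo 0 T ×ˢ Icc 0 1) :=
    (cR'.div cW hne).mul (continuousOn_const.div cW hne)
  have c2 : ContinuousOn (fun p : ℝ × ℝ => (-profile F R A₁ B₁ P₁ p.1 p.2
      / profile F R A B P p.1 p.2) ^ 2 * (1 / profile F R A B P p.1 p.2))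
      (Ioo 0 T ×ˢ Icc 0 1) :=
    ((cW₁.neg.div cW hne).pow 2).mul (continuousOn_const.div cW hne)
  have c3 : ContinuousOn (fun p : ℝ × ℝ => 1 / profile F R A B P p.1 p.2)
      (Ioo 0 T ×ˢ Icc 0 1) := continuousOn_const.div cW hne
  -- Second time derivative of `1/w`, with `w_tt` replaced by `R - I w`. Its integral vanishes, and
  -- since `∫ 1/w = 1` the term in `I` integrates to `I t`.
  have key := hasDerivAt_integral_of_continuousOn
    (h := fun t x => -profile F R A₁ B₁ P₁ t x / (profile F R A B P t x) ^ 2)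
    (h' := fun t x => I t * (1 / profile F R A B P t x)
      - R x / profile F R A B P t x * (1 / profile F R A B P t x)
      + 2 * ((-profile F R A₁ B₁ P₁ t x / profile F R A B P t x) ^ 2
        * (1 / profile F R A B P t x)))
    (cW₁.neg.div (cW.pow 2) fun p hp => pow_ne_zero 2 (hne p hp))
    (((cI'.mul c3).sub c1).add (continuousOn_const.mul c2))
    (fun s hs x hx => by
      have e := hne (s, x) ⟨hs, hx⟩
      simp only at e
      refine ((h.hasDerivAt_profile₁ hs x).fun_neg.fun_div ((hasDerivAt_profile (F := F) (R := R)
        (h.dA s hs) (h.dB s hs) (h.dP s hs) x).fun_pow 2) (pow_ne_zero 2 e)).congr_deriv ?_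
      field_simp
      push_cast
      ring) ht (right_mem_Icc.2 zero_le_one)
  have hz := key.unique ((hasDerivAt_const t (0 : ℝ)).congr_of_eventuallyEq (by
    filter_upwards [Ioo_mem_nhds ht.1 ht.2] with s hs using
      h.integral_velocity_eq_zero cF cR hs))
  have h1 : (1 : ℝ) ∈ Icc (0 : ℝ) 1 := right_mem_Icc.2 zero_le_one
  have i1 := intervalIntegrable_of_continuousOn_unit (continuousOn_slice (h := fun t x =>
    R x / profile F R A B P t x * (1 / profile F R A B P t x)) c1 ht) h1
  have i2 := intervalIntegrable_of_continuousOn_unit (continuousOn_slice (h := fun t x =>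
    (-profile F R A₁ B₁ P₁ t x / profile F R A B P t x) ^ 2
      * (1 / profile F R A B P t x)) c2 ht) h1
  have i3 := intervalIntegrable_of_continuousOn_unit (continuousOn_slice (h := fun t x =>
    1 / profile F R A B P t x) c3 ht) h1
  rw [intervalIntegral.integral_add ((i3.const_mul _).sub i1) (i2.const_mul _),
    intervalIntegral.integral_sub (i3.const_mul _) i1, intervalIntegral.integral_const_mul,
    intervalIntegral.integral_const_mul, h.mass t (hsub ht)] at hz
  linarith

/-- The Eulerian solution associated with a Lagrangian flow. -/
theorem exists_solution {f₀ : ℝ → ℝ} (h : IsFlowCoeff F R T A B P A₁ B₁ P₁ I)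
    (df₀ : ∀ x ∈ Icc (0 : ℝ) 1, HasDerivWithinAt f₀ (F x) (Icc 0 1) x)
    (dF : ∀ x ∈ Icc (0 : ℝ) 1, HasDerivWithinAt F (F₁ x) (Icc 0 1) x)
    (dR : ∀ x ∈ Icc (0 : ℝ) 1, HasDerivWithinAt R (R₁ x) (Icc 0 1) x)
    (cF₁ : ContinuousOn F₁ (Icc 0 1)) (cR₁ : ContinuousOn R₁ (Icc 0 1))
    (hT : 0 < T) (hf₀ : f₀ 0 = 0 ∧ f₀ 1 = 0) (hR : R 0 = 0 ∧ R 1 = 0) :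
    ∃ f ρ : ℝ → ℝ → ℝ, IsDirichletSolution f₀ R T f ρ ∧
      ∀ x, x = 0 ∨ x = 1 → ∀ t ∈ Ico 0 T,
        ∫ s in (0 : ℝ)..t, dX (f s) x = -Real.log (profile F R A B P t x) := by
  have h01 : (1 : ℝ) ∈ Icc (0 : ℝ) 1 := right_mem_Icc.2 zero_le_one
  have h00 : (0 : ℝ) ∈ Icc (0 : ℝ) 1 := left_mem_Icc.2 zero_le_one
  have hsub : Ioo 0 T ⊆ Ico 0 T := Ioo_subset_Ico_self
  have cF : ContinuousOn F (Icc 0 1) := fun x hx => (dF x hx).continuousWithinAt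
  have cR : ContinuousOn R (Icc 0 1) := fun x hx => (dR x hx).continuousWithinAt
  set W := profile F R A B P with hW
  set W₁ := profile F R A₁ B₁ P₁ with hW₁
  have cW : ContinuousOn (fun p : ℝ × ℝ => W p.1 p.2) (Ico 0 T ×ˢ Icc 0 1) :=
    continuousOn_profile cF cR h.cA h.cB h.cP
  have cW₁ : ContinuousOn (fun p : ℝ × ℝ => W₁ p.1 p.2) (Ico 0 T ×ˢ Icc 0 1) :=
    continuousOn_profile cF cR h.cA₁ h.cB₁ h.cP₁
  have dW : ∀ t ∈ Ioo 0 T, ∀ x ∈ Icc (0 : ℝ) 1, HasDerivAt (fun s => W s x) (W₁ t x) t :=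
    fun t ht x _ => hasDerivAt_profile (h.dA t ht) (h.dB t ht) (h.dP t ht) x
  have hpos : ∀ t ∈ Ico 0 T, ∀ x ∈ Icc (0 : ℝ) 1, 0 < W t x := h.pos
  have hmass : ∀ t ∈ Ico 0 T, ∫ x in (0 : ℝ)..1, 1 / W t x = 1 := h.mass
  obtain ⟨X, hXm, hXγ, cX, dXy, dXt⟩ := exists_inverse_flow cW cW₁ dW hpos hmass
  have hne : ∀ t ∈ Ico 0 T, ∀ x ∈ Icc (0 : ℝ) 1, W t x ≠ 0 := fun t ht x hx =>
    (hpos t ht x hx).ne'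
  have hne' : ∀ p ∈ Ico 0 T ×ˢ Icc (0 : ℝ) 1, W p.1 p.2 ≠ 0 := fun p hp =>
    hne p.1 hp.1 p.2 hp.2
  have hX0 : ∀ t ∈ Ico 0 T, X t 0 = 0 := fun t ht => by
    simpa using (hXγ t ht 0 h00).2
  have hX1 : ∀ t ∈ Ico 0 T, X t 1 = 1 := fun t ht => by
    have := (hXγ t ht 1 h01).2
    rwa [hmass t ht] at this
  have hX_init : ∀ x ∈ Icc (0 : ℝ) 1, X 0 x = x := fun x hx => by
    have := (hXγ 0 (left_mem_Ico.2 hT) x hx).2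
    simpa [hW, h.profile_zero] using this
  -- spatial derivatives of the Lagrangian quantities
  set Wx : ℝ → ℝ → ℝ := fun t x => B t * F₁ x + P t * R₁ x with hWx
  set W₁x : ℝ → ℝ → ℝ := fun t x => B₁ t * F₁ x + P₁ t * R₁ x with hW₁x
  have cfst : ∀ {k : ℝ → ℝ}, ContinuousOn k (Ico 0 T) →
      ContinuousOn (fun p : ℝ × ℝ => k p.1) (Ico 0 T ×ˢ Icc (0 : ℝ) 1) := fun hk =>
    hk.comp continuousOn_fst fun p hp => hp.1
  have csnd : ∀ {k : ℝ → ℝ}, ContinuousOn k (Icc 0 1) →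
      ContinuousOn (fun p : ℝ × ℝ => k p.2) (Ico 0 T ×ˢ Icc (0 : ℝ) 1) := fun hk =>
    hk.comp continuousOn_snd fun p hp => hp.2
  have cWx : ContinuousOn (fun p : ℝ × ℝ => Wx p.1 p.2) (Ico 0 T ×ˢ Icc 0 1) :=
    ((cfst h.cB).mul (csnd cF₁)).add ((cfst h.cP).mul (csnd cR₁))
  have cW₁x : ContinuousOn (fun p : ℝ × ℝ => W₁x p.1 p.2) (Ico 0 T ×ˢ Icc 0 1) :=
    ((cfst h.cB₁).mul (csnd cF₁)).add ((cfst h.cP₁).mul (csnd cR₁))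
  have dWx : ∀ t, ∀ x ∈ Icc (0 : ℝ) 1, HasDerivWithinAt (W t) (Wx t x) (Icc 0 1) x :=
    fun t x hx => hasDerivWithinAt_profile (dF x hx) (dR x hx) A B P t
  have dW₁x : ∀ t, ∀ x ∈ Icc (0 : ℝ) 1, HasDerivWithinAt (W₁ t) (W₁x t x) (Icc 0 1) x :=
    fun t x hx => hasDerivWithinAt_profile (dF x hx) (dR x hx) A₁ B₁ P₁ t
  -- In Lagrangian coordinates `V = γ_t` is the velocity, `q` is `f_x` and `r` is `ρ`; `qx` and `rx`
  -- are their derivatives in the label `x`. The Eulerian functions are obtained by composing with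
  -- the inverse flow `X`.
  set V : ℝ → ℝ → ℝ := fun t x => ∫ z in (0 : ℝ)..x, -W₁ t z / (W t z) ^ 2 with hV
  set q : ℝ → ℝ → ℝ := fun t x => -W₁ t x / W t x with hq
  set qx : ℝ → ℝ → ℝ := fun t x => (-W₁x t x * W t x - -W₁ t x * Wx t x) / (W t x) ^ 2 with hqx
  set r : ℝ → ℝ → ℝ := fun t x => R x / W t x with hr
  set rx : ℝ → ℝ → ℝ := fun t x => (R₁ x * W t x - R x * Wx t x) / (W t x) ^ 2 with hrx
  have cV₁ : ContinuousOn (fun p : ℝ × ℝ => -W₁ p.1 p.2 / (W p.1 p.2) ^ 2)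
      (Ico 0 T ×ˢ Icc 0 1) := cW₁.neg.div (cW.pow 2) fun p hp => pow_ne_zero 2 (hne' p hp)
  have cV : ContinuousOn (fun p : ℝ × ℝ => V p.1 p.2) (Ico 0 T ×ˢ Icc 0 1) :=
    continuousOn_integral_joint (h := fun t x => -W₁ t x / (W t x) ^ 2) cV₁
  have cq : ContinuousOn (fun p : ℝ × ℝ => q p.1 p.2) (Ico 0 T ×ˢ Icc 0 1) :=
    cW₁.neg.div cW hne'
  have cqx : ContinuousOn (fun p : ℝ × ℝ => qx p.1 p.2) (Ico 0 T ×ˢ Icc 0 1) :=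
    ((cW₁x.neg.mul cW).sub (cW₁.neg.mul cWx)).div (cW.pow 2)
      fun p hp => pow_ne_zero 2 (hne' p hp)
  have cr : ContinuousOn (fun p : ℝ × ℝ => r p.1 p.2) (Ico 0 T ×ˢ Icc 0 1) :=
    (csnd cR).div cW hne'
  have crx : ContinuousOn (fun p : ℝ × ℝ => rx p.1 p.2) (Ico 0 T ×ˢ Icc 0 1) :=
    (((csnd cR₁).mul cW).sub ((csnd cR).mul cWx)).div (cW.pow 2)
      fun p hp => pow_ne_zero 2 (hne' p hp)
  have dV : ∀ t ∈ Ico 0 T, ∀ x ∈ Icc (0 : ℝ) 1,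
      HasDerivWithinAt (V t) (-W₁ t x / (W t x) ^ 2) (Icc 0 1) x := fun t ht x hx =>
    hasDerivWithinAt_integral_unit
      (continuousOn_slice (h := fun t x => -W₁ t x / (W t x) ^ 2) cV₁ ht) hx
  have dq : ∀ t ∈ Ico 0 T, ∀ x ∈ Icc (0 : ℝ) 1,
      HasDerivWithinAt (q t) (qx t x) (Icc 0 1) x := fun t ht x hx =>
    (dW₁x t x hx).fun_neg.fun_div (dWx t x hx) (hne t ht x hx)
  have dr : ∀ t ∈ Ico 0 T, ∀ x ∈ Icc (0 : ℝ) 1,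
      HasDerivWithinAt (r t) (rx t x) (Icc 0 1) x := fun t ht x hx =>
    (dR x hx).fun_div (dWx t x hx) (hne t ht x hx)
  -- composition with the inverse flow
  have comp_x : ∀ {k : ℝ → ℝ} {k' t y : ℝ}, t ∈ Ico 0 T → y ∈ Icc (0 : ℝ) 1 →
      HasDerivWithinAt k k' (Icc 0 1) (X t y) →
      HasDerivWithinAt (fun z => k (X t z)) (k' * W t (X t y)) (Icc 0 1) y :=
    fun {k k' t y} ht hy hk => hk.comp y (dXy t ht y hy) fun z hz => hXm t ht z hz
  have comp_c : ∀ {k : ℝ → ℝ → ℝ},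
      ContinuousOn (fun p : ℝ × ℝ => k p.1 p.2) (Ico 0 T ×ˢ Icc 0 1) →
      ContinuousOn (fun p : ℝ × ℝ => k p.1 (X p.1 p.2)) (Ico 0 T ×ˢ Icc 0 1) :=
    fun hk => hk.comp (continuousOn_fst.prodMk cX) fun p hp => ⟨hp.1, hXm p.1 hp.1 p.2 hp.2⟩
  set f : ℝ → ℝ → ℝ := fun t y => V t (X t y) with hf
  set ρ : ℝ → ℝ → ℝ := fun t y => r t (X t y) with hρ
  have df : ∀ t ∈ Ico 0 T, ∀ y ∈ Icc (0 : ℝ) 1,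
      HasDerivWithinAt (f t) (q t (X t y)) (Icc 0 1) y := fun t ht y hy => by
    refine (comp_x ht hy (dV t ht _ (hXm t ht y hy))).congr_deriv ?_
    have := hne t ht _ (hXm t ht y hy)
    simp only [hq]
    field_simp
  have efx : ∀ t ∈ Ico 0 T, EqOn (dX (f t)) (fun y => q t (X t y)) (Icc 0 1) :=
    fun t ht y hy => (df t ht y hy).dX_eq hy
  have dfx : ∀ t ∈ Ico 0 T, ∀ y ∈ Icc (0 : ℝ) 1,
      HasDerivWithinAt (dX (f t)) (qx t (X t y) * W t (X t y)) (Icc 0 1) y :=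
    fun t ht y hy => (comp_x ht hy (dq t ht _ (hXm t ht y hy))).congr (efx t ht) (efx t ht hy)
  have efxx : ∀ t ∈ Ico 0 T, EqOn (dX (dX (f t))) (fun y => qx t (X t y) * W t (X t y))
      (Icc 0 1) := fun t ht y hy => (dfx t ht y hy).dX_eq hy
  have dρ : ∀ t ∈ Ico 0 T, ∀ y ∈ Icc (0 : ℝ) 1,
      HasDerivWithinAt (ρ t) (rx t (X t y) * W t (X t y)) (Icc 0 1) y :=
    fun t ht y hy => comp_x ht hy (dr t ht _ (hXm t ht y hy))
  have eρx : ∀ t ∈ Ico 0 T, EqOn (dX (ρ t)) (fun y => rx t (X t y) * W t (X t y))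
      (Icc 0 1) := fun t ht y hy => (dρ t ht y hy).dX_eq hy
  -- time derivatives at a fixed Eulerian point
  have dY : ∀ t ∈ Ioo 0 T, ∀ y ∈ Icc (0 : ℝ) 1,
      HasDerivAt (fun s => X s y) (-(W t (X t y) * f t y)) t := fun t ht y hy => by
    refine (dXt t ht y hy).congr_deriv ?_
    simp only [hf, hV]
    rw [← mul_neg, ← intervalIntegral.integral_neg]
    congr 1
    refine intervalIntegral.integral_congr fun z _ => ?_
    ring
  have comp_t : ∀ {k k₁ : ℝ → ℝ} {t y : ℝ}, t ∈ Ioo 0 T → y ∈ Icc (0 : ℝ) 1 →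
      HasDerivWithinAt k (k₁ (X t y)) (Icc 0 1) (X t y) →
      HasDerivAt (fun s => k (X s y)) (k₁ (X t y) * -(W t (X t y) * f t y)) t := by
    intro k k₁ t y ht hy hk
    refine HasDerivWithinAt.comp_hasDerivAt t (h := fun s => X s y) hk (dY t ht y hy) ?_
    filter_upwards [Ioo_mem_nhds ht.1 ht.2] with s hs using hXm s (hsub hs) y hy
  have dWY : ∀ t ∈ Ioo 0 T, ∀ y ∈ Icc (0 : ℝ) 1, HasDerivAt (fun s => W s (X s y))
      (W₁ t (X t y) + Wx t (X t y) * -(W t (X t y) * f t y)) t := fun t ht y hy =>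
    hasDerivAt_profile_comp (h.dA t ht) (h.dB t ht) (h.dP t ht)
      (comp_t ht hy (dF _ (hXm t (hsub ht) y hy))) (comp_t ht hy (dR _ (hXm t (hsub ht) y hy)))
  have dW₁Y : ∀ t ∈ Ioo 0 T, ∀ y ∈ Icc (0 : ℝ) 1, HasDerivAt (fun s => W₁ s (X s y))
      (R (X t y) - I t * W t (X t y) + W₁x t (X t y) * -(W t (X t y) * f t y)) t := by
    intro t ht y hy
    refine (hasDerivAt_profile_comp (A₁ := fun t => -I t * A t) (B₁ := fun t => -I t * B t)
      (P₁ := fun t => 1 - I t * P t) (h.dA₁ t ht) (h.dB₁ t ht) (h.dP₁ t ht)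
      (comp_t ht hy (dF _ (hXm t (hsub ht) y hy)))
      (comp_t ht hy (dR _ (hXm t (hsub ht) y hy)))).congr_deriv ?_
    simp only [hW, hW₁x, profile]
    ring
  have dfxt : ∀ t ∈ Ioo 0 T, ∀ y ∈ Icc (0 : ℝ) 1, HasDerivAt (fun s => dX (f s) y)
      (I t - ρ t y + (dX (f t) y) ^ 2 - f t y * dX (dX (f t)) y) t := by
    intro t ht y hy
    have hW0 := hne t (hsub ht) _ (hXm t (hsub ht) y hy)
    refine HasDerivAt.congr_of_eventuallyEq (f := fun s => q s (X s y)) ?_ ?_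
    · refine ((dW₁Y t ht y hy).fun_neg.fun_div (dWY t ht y hy) hW0).congr_deriv ?_
      rw [efx t (hsub ht) hy, efxx t (hsub ht) hy]
      simp only [hρ, hr, hq, hqx]
      field_simp
      ring
    · filter_upwards [Ioo_mem_nhds ht.1 ht.2] with s hs using efx s (hsub hs) hy
  have dρt : ∀ t ∈ Ioo 0 T, ∀ y ∈ Icc (0 : ℝ) 1, HasDerivAt (fun s => ρ s y)
      (ρ t y * dX (f t) y - f t y * dX (ρ t) y) t := by
    intro t ht y hy
    have hW0 := hne t (hsub ht) _ (hXm t (hsub ht) y hy)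
    refine ((comp_t ht hy (dR _ (hXm t (hsub ht) y hy))).fun_div (dWY t ht y hy)
      hW0).congr_deriv ?_
    rw [efx t (hsub ht) hy, eρx t (hsub ht) hy]
    simp only [hρ, hr, hq, hrx]
    field_simp
    ring
  -- the nonlocal term, by the change of variables `y = γ(t,x)`
  have cov : ∀ t ∈ Ico 0 T, ∀ k : ℝ → ℝ, ContinuousOn k (Icc 0 1) →
      ∫ y in (0 : ℝ)..1, k (X t y) = ∫ x in (0 : ℝ)..1, k x * (1 / W t x) := by
    intro t ht k hk
    have cinv : ContinuousOn (fun x => 1 / W t x) (Icc 0 1) :=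
      continuousOn_const.div (continuousOn_slice cW ht) fun x hx => hne t ht x hx
    have dγ := fun x (hx : x ∈ Icc (0 : ℝ) 1) => hasDerivWithinAt_integral_unit cinv hx
    have key := intervalIntegral.integral_comp_mul_deriv'' (a := 0) (b := 1)
      (f := fun x => ∫ z in (0 : ℝ)..x, 1 / W t z) (f' := fun x => 1 / W t x)
      (g := fun y => k (X t y)) ?_ ?_ ?_ ?_
    · simp only [intervalIntegral.integral_same, hmass t ht] at key
      rw [← key]
      refine intervalIntegral.integral_congr fun x hx => ?_
      rw [uIcc_of_le zero_le_one] at hx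
      simp only [Function.comp_apply, (hXγ t ht x hx).2]
    · rw [uIcc_of_le zero_le_one]
      exact fun x hx => (dγ x hx).continuousWithinAt
    · rw [min_eq_left zero_le_one, max_eq_right zero_le_one]
      exact fun x hx => ((dγ x (Ioo_subset_Icc_self hx)).hasDerivAt
        (Icc_mem_nhds hx.1 hx.2)).hasDerivWithinAt
    · rwa [uIcc_of_le zero_le_one]
    · rw [uIcc_of_le zero_le_one]
      refine hk.comp ((continuousOn_slice cX ht).mono ?_) ?_
      · rintro _ ⟨x, hx, rfl⟩
        exact (hXγ t ht x hx).1
      · rintro _ ⟨x, hx, rfl⟩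
        exact hXm t ht _ (hXγ t ht x hx).1
  have hI : ∀ t ∈ Ioo 0 T, nonlocalI (f t) (ρ t) = I t := by
    intro t ht
    rw [← h.coeff_eq cF cR ht, nonlocalI, ← cov t (hsub ht) (r t) (continuousOn_slice cr (hsub ht)),
      ← cov t (hsub ht) (fun x => (q t x) ^ 2) ((continuousOn_slice cq (hsub ht)).pow 2)]
    congr 2
    refine intervalIntegral.integral_congr fun y hy => ?_
    rw [uIcc_of_le zero_le_one] at hy
    simp only [efx t (hsub ht) hy]
  have hV1 : ∀ t ∈ Ico 0 T, V t 1 = 0 := by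
    intro t ht
    -- The mass identity can be differentiated only for `t > 0`; at `t = 0` the endpoint velocity is
    -- `∫ f₀' = 0`.
    rcases ht.1.eq_or_lt with rfl | h0
    · simp only [hV, hW, hW₁, h.profile_zero, h.profile₁_zero]
      simp only [neg_neg, one_pow, div_one]
      rw [integral_eq_sub_of_hasDerivWithinAt_unit df₀ cF h01, hf₀.1, hf₀.2, sub_zero]
    · exact h.integral_velocity_eq_zero cF cR ⟨h0, ht.2⟩
  refine ⟨f, ρ, ?_, ?_⟩
  · refine ⟨fun t ht y hy => (df t ht y hy).differentiableWithinAt,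
      fun t ht y hy => (dfx t ht y hy).differentiableWithinAt,
      fun t ht y hy => (dρ t ht y hy).differentiableWithinAt, comp_c cV,
      (comp_c cq).congr fun p hp => efx p.1 hp.1 hp.2,
      ((comp_c cqx).mul (comp_c cW)).congr fun p hp => efxx p.1 hp.1 hp.2, comp_c cr,
      ((comp_c crx).mul (comp_c cW)).congr fun p hp => eρx p.1 hp.1 hp.2,
      fun t ht y hy => (dfxt t ht y hy).differentiableAt,
      fun t ht y hy => (dρt t ht y hy).differentiableAt, ?_, ?_, ?_, ?_, ?_, ?_⟩
    · intro t ht y hy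
      rw [(dfxt t ht y hy).deriv, hI t ht]
      ring
    · intro t ht y hy
      rw [(dρt t ht y hy).deriv]
      ring
    · intro x hx
      simp only [hf, hV, hX_init x hx, hW, hW₁, h.profile_zero, h.profile₁_zero, neg_neg,
        one_pow, div_one]
      rw [integral_eq_sub_of_hasDerivWithinAt_unit df₀ cF hx, hf₀.1, sub_zero]
    · intro x hx
      simp only [hρ, hr, hX_init x hx, hW, h.profile_zero, div_one]
    · intro t ht
      refine ⟨?_, ?_⟩
      · simp [hf, hX0 t ht, hV]
      · simp [hf, hX1 t ht, hV1 t ht]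
    · intro t ht
      simp [hρ, hr, hX0 t ht, hX1 t ht, hR.1, hR.2]
  · intro x hx t ht
    have hxm : x ∈ Icc (0 : ℝ) 1 := by rcases hx with rfl | rfl <;> assumption
    have hXx : ∀ s ∈ Ico 0 T, X s x = x := by
      intro s hs
      rcases hx with rfl | rfl
      exacts [hX0 s hs, hX1 s hs]
    have hs : Icc 0 t ⊆ Ico 0 T := fun s hs => ⟨hs.1, hs.2.trans_lt ht.2⟩
    have e1 : ∫ s in (0 : ℝ)..t, dX (f s) x = ∫ s in (0 : ℝ)..t, q s x := by
      refine intervalIntegral.integral_congr fun s hs' => ?_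
      rw [uIcc_of_le ht.1] at hs'
      rw [efx s (hs hs') hxm]
      simp only [hXx s (hs hs')]
    -- Endpoints are fixed by the flow, so `f_x` there is `q = -w_t/w`, the derivative of `-log w`.
    rw [e1, intervalIntegral.integral_eq_sub_of_hasDerivAt_of_le ht.1
      (f := fun s => -Real.log (W s x)) (f' := fun s => q s x)]
    · simp [hW, h.profile_zero]
    · exact (((continuousOn_slice_left cW hxm).mono hs).log
        fun s hs' => hne s (hs hs') x hxm).neg
    · intro s hs'
      have := hs (Ioo_subset_Icc_self hs')
      refine ((dW s ⟨hs'.1, this.2⟩ x hxm).log (hne s this x hxm)).fun_neg.congr_deriv ?_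
      simp only [hq]
      ring
    · refine ContinuousOn.intervalIntegrable ?_
      rw [uIcc_of_le ht.1]
      exact (continuousOn_slice_left cq hxm).mono hs

end IsFlowCoeff

/-! ### The scalar ODE for `Q`. -/

/-- The total mass `∫₀¹ dx / (1 - η⁺ F + q⁺ R)`. -/
noncomputable def massFn (F R : ℝ → ℝ) (η q : ℝ) : ℝ :=
  ∫ x in (0 : ℝ)..1, 1 / (1 + -max η 0 * F x + max q 0 * R x)

section massFn

variable {F R : ℝ → ℝ} {M : ℝ}

/-- The positive parts in `massFn` serve this bound: it holds for every real `q` and for negative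
`η` as well, so the vector field is defined, bounded and Lipschitz on whole strips `η ≤ c` around
the initial time. They disappear once `η ≥ 0` and `Q ≥ 0` are known. -/
theorem one_sub_mul_le_denom (hR : ∀ x ∈ Icc (0 : ℝ) 1, 0 ≤ R x)
    (hF : ∀ x ∈ Icc (0 : ℝ) 1, F x ≤ M) (hM : 0 < M) {c η q : ℝ} (hc : 0 ≤ c) (hη : η ≤ c)
    {x : ℝ} (hx : x ∈ Icc (0 : ℝ) 1) :
    1 - c * M ≤ 1 + -max η 0 * F x + max q 0 * R x := by
  have h1 : max η 0 * F x ≤ c * M :=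
    (mul_le_mul_of_nonneg_left (hF x hx) (le_max_right _ _)).trans
      (mul_le_mul_of_nonneg_right (max_le hη hc) hM.le)
  have h2 := mul_nonneg (le_max_right q 0) (hR x hx)
  linarith

theorem one_sub_mul_pos (hM : 0 < M) {c : ℝ} (hc : c < 1 / M) : 0 < 1 - c * M := by
  rw [lt_div_iff₀ hM] at hc
  linarith

theorem denom_pos (hR : ∀ x ∈ Icc (0 : ℝ) 1, 0 ≤ R x)
    (hF : ∀ x ∈ Icc (0 : ℝ) 1, F x ≤ M) (hM : 0 < M) {η q : ℝ} (hη : η < 1 / M)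
    {x : ℝ} (hx : x ∈ Icc (0 : ℝ) 1) : 0 < 1 + -max η 0 * F x + max q 0 * R x :=
  (one_sub_mul_pos hM (max_lt hη (by positivity))).trans_le
    (one_sub_mul_le_denom hR hF hM (le_max_right η 0) (le_max_left η 0) hx)

theorem continuousOn_inv_profile {A B P : ℝ → ℝ} {S : Set ℝ} (cF : ContinuousOn F (Icc 0 1))
    (cR : ContinuousOn R (Icc 0 1)) (cA : ContinuousOn A S) (cB : ContinuousOn B S)
    (cP : ContinuousOn P S)
    (hpos : ∀ t ∈ S, ∀ x ∈ Icc (0 : ℝ) 1, 0 < profile F R A B P t x) :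
    ContinuousOn (fun p : ℝ × ℝ => 1 / profile F R A B P p.1 p.2) (S ×ˢ Icc 0 1) :=
  continuousOn_const.div (continuousOn_profile cF cR cA cB cP)
    fun p hp => (hpos p.1 hp.1 p.2 hp.2).ne'

theorem integral_pos_unit {u : ℝ → ℝ} (hu : ContinuousOn u (Icc 0 1))
    (h : ∀ x ∈ Icc (0 : ℝ) 1, 0 < u x) : 0 < ∫ x in (0 : ℝ)..1, u x :=
  intervalIntegral.integral_pos zero_lt_one hu
    (fun x hx => (h x (Ioc_subset_Icc_self hx)).le) ⟨0, by simp, h 0 (by simp)⟩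

theorem continuousOn_massFn (cF : ContinuousOn F (Icc 0 1)) (cR : ContinuousOn R (Icc 0 1))
    (hR : ∀ x ∈ Icc (0 : ℝ) 1, 0 ≤ R x) (hF : ∀ x ∈ Icc (0 : ℝ) 1, F x ≤ M) (hM : 0 < M)
    {Q : ℝ → ℝ} {S : Set ℝ} (hS : S ⊆ Iio (1 / M)) (cQ : ContinuousOn Q S) :
    ContinuousOn (fun η => massFn F R η (Q η)) S :=
  continuousOn_integral_unit (h := fun η x =>
      1 / profile F R (fun _ => 1) (fun η => -max η 0) (fun η => max (Q η) 0) η x)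
    (continuousOn_inv_profile cF cR (by fun_prop) (by fun_prop) (by fun_prop)
      fun η hη x hx => denom_pos hR hF hM (hS hη) hx)

theorem continuousOn_denom_inv (cF : ContinuousOn F (Icc 0 1)) (cR : ContinuousOn R (Icc 0 1))
    (hR : ∀ x ∈ Icc (0 : ℝ) 1, 0 ≤ R x) (hF : ∀ x ∈ Icc (0 : ℝ) 1, F x ≤ M) (hM : 0 < M)
    {η q : ℝ} (hη : η < 1 / M) :
    ContinuousOn (fun x => 1 / (1 + -max η 0 * F x + max q 0 * R x)) (Icc 0 1) :=
  continuousOn_const.div (by fun_prop) fun x hx => (denom_pos hR hF hM hη hx).ne'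

theorem massFn_pos (cF : ContinuousOn F (Icc 0 1)) (cR : ContinuousOn R (Icc 0 1))
    (hR : ∀ x ∈ Icc (0 : ℝ) 1, 0 ≤ R x) (hF : ∀ x ∈ Icc (0 : ℝ) 1, F x ≤ M) (hM : 0 < M)
    {η q : ℝ} (hη : η < 1 / M) : 0 < massFn F R η q :=
  integral_pos_unit (continuousOn_denom_inv cF cR hR hF hM hη)
    fun _ hx => one_div_pos.2 (denom_pos hR hF hM hη hx)

theorem massFn_le (cF : ContinuousOn F (Icc 0 1)) (cR : ContinuousOn R (Icc 0 1))
    (hR : ∀ x ∈ Icc (0 : ℝ) 1, 0 ≤ R x) (hF : ∀ x ∈ Icc (0 : ℝ) 1, F x ≤ M) (hM : 0 < M)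
    {c η q : ℝ} (hc0 : 0 ≤ c) (hc : c < 1 / M) (hη : η ≤ c) :
    massFn F R η q ≤ 1 / (1 - c * M) := by
  refine (integral_mono_unit (v := fun _ => 1 / (1 - c * M))
    (continuousOn_denom_inv cF cR hR hF hM (hη.trans_lt hc)) continuousOn_const
    fun x hx => ?_).trans_eq (by simp)
  exact one_div_le_one_div_of_le (one_sub_mul_pos hM hc) (one_sub_mul_le_denom hR hF hM hc0 hη hx)

/-- The difference of two reciprocals is the difference of denominators, at most `N |q₁ - q₂|`, over
a product bounded below by `(1 - c M)²`. -/
theorem abs_massFn_sub_le (cF : ContinuousOn F (Icc 0 1)) (cR : ContinuousOn R (Icc 0 1))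
    (hR : ∀ x ∈ Icc (0 : ℝ) 1, 0 ≤ R x) (hF : ∀ x ∈ Icc (0 : ℝ) 1, F x ≤ M) (hM : 0 < M)
    {N : ℝ} (hN : ∀ x ∈ Icc (0 : ℝ) 1, R x ≤ N)
    {c η q₁ q₂ : ℝ} (hc0 : 0 ≤ c) (hc : c < 1 / M) (hη : η ≤ c) :
    |massFn F R η q₁ - massFn F R η q₂| ≤ N / (1 - c * M) ^ 2 * |q₁ - q₂| := by
  have h1 : (1 : ℝ) ∈ Icc (0 : ℝ) 1 := right_mem_Icc.2 zero_le_one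
  have cc := fun q => continuousOn_denom_inv (q := q) cF cR hR hF hM (hη.trans_lt hc)
  rw [massFn, massFn, ← intervalIntegral.integral_sub
    (intervalIntegrable_of_continuousOn_unit (cc q₁) h1)
    (intervalIntegrable_of_continuousOn_unit (cc q₂) h1)]
  have key := intervalIntegral.norm_integral_le_of_norm_le_const (a := (0 : ℝ)) (b := 1)
    (f := fun x => 1 / (1 + -max η 0 * F x + max q₁ 0 * R x)
      - 1 / (1 + -max η 0 * F x + max q₂ 0 * R x))
    (C := N / (1 - c * M) ^ 2 * |q₁ - q₂|) ?_
  · simpa using key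
  · intro x hx
    rw [uIoc_of_le zero_le_one] at hx
    have hx' := Ioc_subset_Icc_self hx
    have m0 := one_sub_mul_pos hM hc
    have d₁ := one_sub_mul_le_denom (q := q₁) hR hF hM hc0 hη hx'
    have d₂ := one_sub_mul_le_denom (q := q₂) hR hF hM hc0 hη hx'
    have p₁ := m0.trans_le d₁
    have p₂ := m0.trans_le d₂
    rw [Real.norm_eq_abs, div_sub_div _ _ p₁.ne' p₂.ne', abs_div, abs_of_pos (mul_pos p₁ p₂),
      div_mul_eq_mul_div]
    have hmax : |max q₂ 0 - max q₁ 0| ≤ |q₁ - q₂| := by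
      rw [abs_sub_comm q₁]
      exact abs_max_sub_max_le_abs q₂ q₁ 0
    refine div_le_div₀ (mul_nonneg ((hR x hx').trans (hN x hx')) (abs_nonneg _)) ?_
      (by positivity) (by nlinarith)
    have e : 1 * (1 + -max η 0 * F x + max q₂ 0 * R x)
        - (1 + -max η 0 * F x + max q₁ 0 * R x) * 1 = R x * (max q₂ 0 - max q₁ 0) := by ring
    rw [e, abs_mul, abs_of_nonneg (hR x hx')]
    exact mul_le_mul (hN x hx') hmax (abs_nonneg _) ((hR x hx').trans (hN x hx'))

/-- The vector field of `Q'' = (massFn η Q)³`, with the velocity scaled by `l`. -/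
noncomputable def massField (F R : ℝ → ℝ) (l η : ℝ) (z : ℝ × ℝ) : ℝ × ℝ :=
  (z.2 / l, l * massFn F R η z.1 ^ 3)

theorem exists_lipschitzWith_massField (cF : ContinuousOn F (Icc 0 1))
    (cR : ContinuousOn R (Icc 0 1))
    (hR : ∀ x ∈ Icc (0 : ℝ) 1, 0 ≤ R x) (hF : ∀ x ∈ Icc (0 : ℝ) 1, F x ≤ M) (hM : 0 < M)
    {l c : ℝ} (hl : 0 < l) (hc : c < 1 / M) :
    ∃ K : NNReal, ∀ η ≤ c, LipschitzWith K (massField F R l η) := by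
  wlog hc0 : 0 ≤ c generalizing c
  · obtain ⟨K, hK⟩ := this (c := 0) (by positivity) le_rfl
    exact ⟨K, fun η hη => hK η (hη.trans (not_le.1 hc0).le)⟩
  obtain ⟨N, hN⟩ := isCompact_Icc.exists_bound_of_continuousOn cR
  have hN' : ∀ x ∈ Icc (0 : ℝ) 1, R x ≤ N := fun x hx => (le_abs_self _).trans (hN x hx)
  have hN0 : 0 ≤ N := (norm_nonneg _).trans (hN 0 (by simp))
  have m0 := one_sub_mul_pos hM hc
  set m := 1 - c * M with hm
  refine ⟨max (NNReal.mk (1 / l) (by positivity)) (NNReal.mk (l * (3 * (1 / m) ^ 2 * (N / m ^ 2))) (by positivity)),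
    fun η hη => ?_⟩
  refine LipschitzWith.prodMk ?_ ?_
  · refine LipschitzWith.of_dist_le_mul fun z w => ?_
    rw [Real.dist_eq, ← sub_div, abs_div, abs_of_pos hl, NNReal.coe_mk, div_eq_mul_one_div,
      mul_comm]
    exact mul_le_mul_of_nonneg_left (by
      rw [Prod.dist_eq, ← Real.dist_eq]; exact le_max_right _ _) (by positivity)
  · refine LipschitzWith.of_dist_le_mul fun z w => ?_
    rw [Real.dist_eq, ← mul_sub, abs_mul, abs_of_pos hl, NNReal.coe_mk, mul_assoc]
    refine mul_le_mul_of_nonneg_left ?_ hl.le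
    have h1 := abs_massFn_sub_le (q₁ := z.1) (q₂ := w.1) cF cR hR hF hM hN' hc0 hc hη
    have hz := massFn_le (q := z.1) cF cR hR hF hM hc0 hc hη
    have hw := massFn_le (q := w.1) cF cR hR hF hM hc0 hc hη
    have pz := massFn_pos (q := z.1) cF cR hR hF hM (hη.trans_lt hc)
    have pw := massFn_pos (q := w.1) cF cR hR hF hM (hη.trans_lt hc)
    rw [← hm] at h1 hz hw
    set a := massFn F R η z.1
    set b := massFn F R η w.1
    have hd : |z.1 - w.1| ≤ dist z w := by
      rw [Prod.dist_eq, ← Real.dist_eq]; exact le_max_left _ _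
    -- Both masses lie in `(0, 1/m]`, so the cube is Lipschitz there with constant `3 / m²`.
    have e : a ^ 3 - b ^ 3 = (a ^ 2 + a * b + b ^ 2) * (a - b) := by ring
    have hs : a ^ 2 + a * b + b ^ 2 ≤ 3 * (1 / m) ^ 2 := by nlinarith
    rw [e, abs_mul, abs_of_pos (by positivity), mul_assoc]
    exact mul_le_mul hs (h1.trans (mul_le_mul_of_nonneg_left hd (by positivity)))
      (abs_nonneg _) (by positivity)

/-- One application of Picard–Lindelöf covers the whole interval because the velocity is rescaled by
`l = max c 1`, the longer distance from `0` to its ends. On the ball of radius `l²/m³` the rescaled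
field is bounded by `l/m³`, and this bound times `l` is exactly the radius. Scaling back then gives
the solution of the original system. -/
theorem exists_massField_solution_of_lt (cF : ContinuousOn F (Icc 0 1))
    (cR : ContinuousOn R (Icc 0 1))
    (hR : ∀ x ∈ Icc (0 : ℝ) 1, 0 ≤ R x) (hF : ∀ x ∈ Icc (0 : ℝ) 1, F x ≤ M) (hM : 0 < M)
    {c : ℝ} (hc0 : 0 < c) (hc : c < 1 / M) :
    ∃ α : ℝ → ℝ × ℝ, α 0 = 0 ∧
      ∀ η ∈ Ioo (-1) c, HasDerivAt α (massField F R 1 η (α η)) η := by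
  have m0 := one_sub_mul_pos hM hc
  set m := 1 - c * M with hm
  set l : ℝ := max c 1 with hl
  have l0 : 0 < l := hc0.trans_le (le_max_left _ _)
  obtain ⟨K, hK⟩ := exists_lipschitzWith_massField cF cR hR hF hM l0 hc
  have hC : (0 : ℝ) ≤ (1 / m) ^ 3 := by positivity
  have hPL : IsPicardLindelof (massField F R l) (tmin := -1) (tmax := c)
      ⟨0, ⟨by norm_num, hc0.le⟩⟩ 0 (NNReal.mk (l ^ 2 * (1 / m) ^ 3) (by positivity)) 0
      (NNReal.mk (l * (1 / m) ^ 3) (by positivity)) K := by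
    refine ⟨fun η hη => (hK η hη.2).lipschitzOnWith, fun z _ => ?_, fun η hη z hz => ?_, ?_⟩
    · have h1 := continuousOn_massFn (Q := fun _ => z.1) (S := Icc (-1) c) cF cR hR hF hM
        (fun η hη => hη.2.trans_lt hc) continuousOn_const
      exact continuousOn_const.prodMk (continuousOn_const.mul (h1.pow 3))
    · rw [mem_closedBall_zero_iff, NNReal.coe_mk] at hz
      rw [massField, Prod.norm_mk, NNReal.coe_mk]
      refine max_le ?_ ?_
      · have h2 : ‖z.2‖ ≤ ‖z‖ := norm_snd_le z
        rw [norm_div, Real.norm_of_nonneg l0.le, div_le_iff₀ l0]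
        nlinarith
      · have h3 := massFn_le (q := z.1) cF cR hR hF hM hc0.le hc hη.2
        have h4 := massFn_pos (q := z.1) cF cR hR hF hM (hη.2.trans_lt hc)
        rw [Real.norm_of_nonneg (by positivity)]
        exact mul_le_mul_of_nonneg_left (pow_le_pow_left₀ h4.le h3 3) l0.le
    · simp only [NNReal.coe_mk, sub_zero, zero_sub, neg_neg, NNReal.coe_zero]
      rw [← hl]
      exact le_of_eq (by ring)
  obtain ⟨α, h0, hα⟩ := hPL.exists_eq_forall_mem_Icc_hasDerivWithinAt₀
  refine ⟨fun η => ((α η).1, (α η).2 / l), ?_, fun η hη => ?_⟩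
  · simp only at h0
    simp [h0]
  · have h1 := (hα η (Ioo_subset_Icc_self hη)).hasDerivAt (Icc_mem_nhds hη.1 hη.2)
    have h2 := (hasFDerivAt_fst.comp_hasDerivAt η h1).prodMk
      ((hasFDerivAt_snd.comp_hasDerivAt η h1).div_const l)
    refine h2.congr_deriv ?_
    simp [massField, l0.ne']

/-- Global solution of `Q'' = (∫₀¹ dx / (1 - η F + Q R))³` with `Q = Q' = 0` at `η = 0`. -/
theorem exists_mass_ode_solution (cF : ContinuousOn F (Icc 0 1)) (cR : ContinuousOn R (Icc 0 1))
    (hR : ∀ x ∈ Icc (0 : ℝ) 1, 0 ≤ R x) (hF : ∀ x ∈ Icc (0 : ℝ) 1, F x ≤ M) (hM : 0 < M) :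
    ∃ Q Q₁ : ℝ → ℝ, Q 0 = 0 ∧ Q₁ 0 = 0 ∧
      (∀ η ∈ Ioo (-1) (1 / M), HasDerivAt Q (Q₁ η) η) ∧
      (∀ η ∈ Ioo (-1) (1 / M), HasDerivAt Q₁ (massFn F R η (Q η) ^ 3) η) ∧
      ∀ η ∈ Ico 0 (1 / M), 0 ≤ Q η := by
  have hb : 0 < 1 / M := by positivity
  -- Starting at `-1` makes `η = 0` an interior point, where two-sided derivatives are available.
  obtain ⟨α, h0, hα⟩ := exists_ode_solution_glue (v := massField F R 1) (a := -1) (b := 1 / M)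
    (t₀ := 0) (x₀ := 0) (by norm_num) hb
    (fun c hc => by
      obtain ⟨K, hK⟩ := exists_lipschitzWith_massField cF cR hR hF hM one_pos hc
      exact ⟨K, fun η hη => hK η hη.2.le⟩)
    (fun c hc0 hc => exists_massField_solution_of_lt cF cR hR hF hM hc0 hc)
  have d1 : ∀ η ∈ Ioo (-1) (1 / M), HasDerivAt (fun η => (α η).1) (α η).2 η := fun η hη =>
    (hasFDerivAt_fst.comp_hasDerivAt η (hα η hη)).congr_deriv (by simp [massField])
  have d2 : ∀ η ∈ Ioo (-1) (1 / M),
      HasDerivAt (fun η => (α η).2) (massFn F R η (α η).1 ^ 3) η := fun η hη =>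
    (hasFDerivAt_snd.comp_hasDerivAt η (hα η hη)).congr_deriv (by simp [massField])
  -- Used twice: `Q'' ≥ 0` gives `Q' ≥ 0`, which gives `Q ≥ 0`.
  have hmono : ∀ {u u' : ℝ → ℝ}, (∀ η ∈ Ioo (-1) (1 / M), HasDerivAt u (u' η) η) →
      (∀ η ∈ Ico 0 (1 / M), 0 ≤ u' η) → u 0 = 0 → ∀ η ∈ Ico 0 (1 / M), 0 ≤ u η := by
    intro u u' hu hu' hu0 η hη
    have hsub : Ico 0 (1 / M) ⊆ Ioo (-1) (1 / M) := fun s hs => ⟨by linarith [hs.1], hs.2⟩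
    have := monotoneOn_of_deriv_nonneg (convex_Ico 0 (1 / M))
      (fun s hs => (hu s (hsub hs)).continuousAt.continuousWithinAt)
      (fun s hs => (hu s (hsub (interior_subset hs))).differentiableAt.differentiableWithinAt)
      (fun s hs => by
        rw [(hu s (hsub (interior_subset hs))).deriv]
        exact hu' s (interior_subset hs))
      (left_mem_Ico.2 hb) hη hη.1
    rwa [hu0] at this
  refine ⟨fun η => (α η).1, fun η => (α η).2, by simp [h0], by simp [h0], d1, d2, ?_⟩
  refine hmono d1 (hmono d2 (fun η hη => ?_) (by simp [h0])) (by simp [h0])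
  exact pow_nonneg (massFn_pos cF cR hR hF hM hη.2).le 3

end massFn

/-! ### Change of time and construction of the Lagrangian coefficients. -/

/-- The change of time `t = ∫₀^η φ²` and its inverse. -/
theorem exists_time_change {b L : ℝ} {φ : ℝ → ℝ} (hb : 0 < b)
    (cφ : ContinuousOn φ (Ioo (-1) b)) (hφ : ∀ η ∈ Ioo (-1) b, 0 < φ η)
    (hL : ∀ η ∈ Ico 0 b, ∫ μ in (0 : ℝ)..η, φ μ ^ 2 ≤ L) :
    ∃ (T : ℝ) (S : ℝ → ℝ), 0 < T ∧ T ≤ L ∧ S 0 = 0 ∧ MapsTo S (Ico 0 T) (Ico 0 b) ∧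
      MapsTo S (Ioo 0 T) (Ioo 0 b) ∧ ContinuousOn S (Ico 0 T) ∧
      (∀ t ∈ Ioo 0 T, HasDerivAt S (φ (S t) ^ 2)⁻¹ t) ∧ Tendsto S (𝓝[<] T) (𝓝[<] b) := by
  set τ : ℝ → ℝ := fun η => ∫ μ in (0 : ℝ)..η, φ μ ^ 2 with hτ
  have c2 : ContinuousOn (fun μ => φ μ ^ 2) (Ioo (-1) b) := cφ.pow 2
  have hord : ∀ {η}, η ∈ Ioo (-1) b → uIcc 0 η ⊆ Ioo (-1) b := fun hη =>
    ordConnected_Ioo.uIcc_subset ⟨by norm_num, hb⟩ hη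
  have hsub : Ico 0 b ⊆ Ioo (-1) b := fun s hs => ⟨by linarith [hs.1], hs.2⟩
  have dτ : ∀ η ∈ Ioo (-1) b, HasDerivAt τ (φ η ^ 2) η := fun η hη =>
    intervalIntegral.integral_hasDerivAt_right ((c2.mono (hord hη)).intervalIntegrable)
      (c2.stronglyMeasurableAtFilter isOpen_Ioo η hη)
      (c2.continuousAt (Ioo_mem_nhds hη.1 hη.2))
  obtain ⟨hmono, S, hS, dS⟩ := exists_inverse_of_deriv_pos dτ fun η hη => pow_pos (hφ η hη) 2
  have hτ0 : τ 0 = 0 := by simp [hτ]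
  have hbdd : BddAbove (τ '' Ico 0 b) := ⟨L, by rintro _ ⟨η, hη, rfl⟩; exact hL η hη⟩
  have hne : (τ '' Ico 0 b).Nonempty := ⟨_, mem_image_of_mem τ (left_mem_Ico.2 hb)⟩
  -- The lifespan is the supremum of the new time; strict monotonicity keeps it from being attained,
  -- so `[0, b)` corresponds exactly to `[0, T)`.
  set T := sSup (τ '' Ico 0 b) with hT
  have hltT : ∀ η ∈ Ico 0 b, τ η < T := by
    intro η hη
    obtain ⟨η', h1, h2⟩ := exists_between hη.2
    have hη' : η' ∈ Ico 0 b := ⟨hη.1.trans h1.le, h2⟩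
    exact (hmono (hsub hη) (hsub hη') h1).trans_le (le_csSup hbdd (mem_image_of_mem τ hη'))
  have hT0 : 0 < T := hτ0 ▸ hltT 0 (left_mem_Ico.2 hb)
  have hex : ∀ t ∈ Ico 0 T, ∃ η ∈ Ico 0 b, τ η = t := by
    intro t ht
    obtain ⟨_, ⟨η', hη', rfl⟩, hlt⟩ := exists_lt_of_lt_csSup hne ht.2
    have hs : Icc 0 η' ⊆ Ico 0 b := fun s hs => ⟨hs.1, hs.2.trans_lt hη'.2⟩
    have := intermediate_value_Icc hη'.1
      (fun s hs' => (dτ s (hsub (hs hs'))).continuousAt.continuousWithinAt :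
        ContinuousOn τ (Icc 0 η'))
    rw [hτ0] at this
    obtain ⟨η, hη, e⟩ := this ⟨ht.1, hlt.le⟩
    exact ⟨η, hs hη, e⟩
  have hmaps : MapsTo S (Ico 0 T) (Ico 0 b) := by
    intro t ht
    obtain ⟨η, hη, rfl⟩ := hex t ht
    rwa [hS η (hsub hη)]
  have dS' : ∀ t ∈ Ico 0 T, HasDerivAt S (φ (S t) ^ 2)⁻¹ t := by
    intro t ht
    obtain ⟨η, hη, rfl⟩ := hex t ht
    rw [hS η (hsub hη)]
    exact dS η (hsub hη)
  refine ⟨T, S, hT0, csSup_le hne (by rintro _ ⟨η, hη, rfl⟩; exact hL η hη), ?_, hmaps, ?_,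
    fun t ht => (dS' t ht).continuousAt.continuousWithinAt,
    fun t ht => dS' t (Ioo_subset_Ico_self ht), ?_⟩
  · have := hS 0 (hsub (left_mem_Ico.2 hb))
    rwa [hτ0] at this
  · intro t ht
    obtain ⟨η, hη, rfl⟩ := hex t (Ioo_subset_Ico_self ht)
    rw [hS η (hsub hη)]
    refine ⟨hη.1.lt_of_ne ?_, hη.2⟩
    rintro rfl
    rw [hτ0] at ht
    exact lt_irrefl _ ht.1
  · refine tendsto_nhdsWithin_iff.2 ⟨tendsto_order.2 ⟨fun c hc => ?_, fun c hc => ?_⟩, ?_⟩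
    · set c' := max c 0 with hc'
      have hcm : c' ∈ Ico 0 b := ⟨le_max_right _ _, max_lt hc hb⟩
      have h0 : 0 ≤ τ c' := hτ0 ▸ hmono.monotoneOn (hsub (left_mem_Ico.2 hb)) (hsub hcm) hcm.1
      filter_upwards [Ioo_mem_nhdsLT (hltT c' hcm)] with t ht
      obtain ⟨η, hη, rfl⟩ := hex t ⟨h0.trans ht.1.le, ht.2⟩
      rw [hS η (hsub hη)]
      exact (le_max_left c 0).trans_lt ((hmono.lt_iff_lt (hsub hcm) (hsub hη)).1 ht.1)
    · filter_upwards [Ioo_mem_nhdsLT hT0] with t ht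
      exact (hmaps (Ioo_subset_Ico_self ht)).2.trans hc
    · filter_upwards [Ioo_mem_nhdsLT hT0] with t ht
      exact (hmaps (Ioo_subset_Ico_self ht)).2

/-- The ansatz `w = φ (1 - η F + Q R)` with `dt = φ² dη` solves the linear problem. The comparison
`φ ≤ ∫ dx/(1 - η F)`, valid since `Q R ≥ 0`, transfers both the bound `L` on the lifespan and the
decay `hdecay` from the explicit integral to `φ`. -/
theorem exists_flowCoeff {F R : ℝ → ℝ} {M L : ℝ} (cF : ContinuousOn F (Icc 0 1))
    (cR : ContinuousOn R (Icc 0 1))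
    (hR : ∀ x ∈ Icc (0 : ℝ) 1, 0 ≤ R x) (hF : ∀ x ∈ Icc (0 : ℝ) 1, F x ≤ M) (hM : 0 < M)
    (hmean : ∫ x in (0 : ℝ)..1, F x = 0)
    (hL : ∀ η ∈ Ico 0 (1 / M),
      ∫ μ in (0 : ℝ)..η, (∫ x in (0 : ℝ)..1, 1 / (1 - μ * F x)) ^ 2 ≤ L)
    (hdecay : Tendsto (fun η => (1 - η * M) * ∫ x in (0 : ℝ)..1, 1 / (1 - η * F x))
      (𝓝[<] (1 / M)) (𝓝 0)) :
    ∃ (T : ℝ) (A B P A₁ B₁ P₁ I : ℝ → ℝ), 0 < T ∧ T ≤ L ∧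
      IsFlowCoeff F R T A B P A₁ B₁ P₁ I ∧
      ∀ x, F x = M → R x = 0 →
        Tendsto (fun t => profile F R A B P t x) (𝓝[<] T) (𝓝 0) := by
  obtain ⟨Q, Q₁, hQ0, hQ₁0, dQ, dQ₁, hQ⟩ := exists_mass_ode_solution cF cR hR hF hM
  set b := 1 / M with hbdef
  have hb : 0 < b := by positivity
  have h01 : (1 : ℝ) ∈ Icc (0 : ℝ) 1 := right_mem_Icc.2 zero_le_one
  have hsub : Ico 0 b ⊆ Ioo (-1) b := fun s hs => ⟨by linarith [hs.1], hs.2⟩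
  have hsub' : Ioo 0 b ⊆ Ico 0 b := Ioo_subset_Ico_self
  set φ : ℝ → ℝ := fun η => massFn F R η (Q η) with hφ
  have cQ : ContinuousOn Q (Ioo (-1) b) := fun η hη => (dQ η hη).continuousAt.continuousWithinAt
  have cQ₁ : ContinuousOn Q₁ (Ioo (-1) b) := fun η hη =>
    (dQ₁ η hη).continuousAt.continuousWithinAt
  have cφ : ContinuousOn φ (Ioo (-1) b) :=
    continuousOn_massFn cF cR hR hF hM (fun η hη => hη.2) cQ
  have φpos : ∀ η ∈ Ioo (-1) b, 0 < φ η := fun η hη => massFn_pos cF cR hR hF hM hη.2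
  -- the profile in the variable `η`
  set D := profile F R (fun _ => 1) (fun η => -η) Q with hD
  set D₁ := profile F R (fun _ => 0) (fun _ => -1) Q₁ with hD₁
  set D₂ := profile F R (fun _ => 0) (fun _ => 0) (fun η => φ η ^ 3) with hD₂
  have hDeq : ∀ η ∈ Ico 0 b, ∀ x, D η x = 1 + -max η 0 * F x + max (Q η) 0 * R x := by
    intro η hη x
    simp only [hD, profile, max_eq_left hη.1, max_eq_left (hQ η hη)]
  have Dpos : ∀ η ∈ Ico 0 b, ∀ x ∈ Icc (0 : ℝ) 1, 0 < D η x := by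
    intro η hη x hx
    rw [hDeq η hη]
    exact denom_pos hR hF hM hη.2 hx
  have hφD : ∀ η ∈ Ico 0 b, φ η = ∫ x in (0 : ℝ)..1, 1 / D η x := by
    intro η hη
    refine intervalIntegral.integral_congr fun x _ => ?_
    simp only [hDeq η hη]
  have hD0pos : ∀ η ∈ Ico 0 b, ∀ x ∈ Icc (0 : ℝ) 1, 0 < 1 - η * F x := by
    intro η hη x hx
    have h1 := one_sub_mul_pos hM hη.2
    have h2 := mul_le_mul_of_nonneg_left (hF x hx) hη.1
    linarith
  have cD : ContinuousOn (fun p : ℝ × ℝ => D p.1 p.2) (Ico 0 b ×ˢ Icc 0 1) :=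
    continuousOn_profile cF cR continuousOn_const (by fun_prop) (cQ.mono hsub)
  have cD₁ : ContinuousOn (fun p : ℝ × ℝ => D₁ p.1 p.2) (Ico 0 b ×ˢ Icc 0 1) :=
    continuousOn_profile cF cR continuousOn_const continuousOn_const (cQ₁.mono hsub)
  have cD₂ : ContinuousOn (fun p : ℝ × ℝ => D₂ p.1 p.2) (Ico 0 b ×ˢ Icc 0 1) :=
    continuousOn_profile cF cR continuousOn_const continuousOn_const ((cφ.pow 3).mono hsub)
  have dD : ∀ η ∈ Ioo 0 b, ∀ x, HasDerivAt (fun s => D s x) (D₁ η x) η := fun η hη x =>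
    hasDerivAt_profile (hasDerivAt_const η _) (hasDerivAt_neg η) (dQ η (hsub (hsub' hη))) x
  have dD₁ : ∀ η ∈ Ioo 0 b, ∀ x, HasDerivAt (fun s => D₁ s x) (D₂ η x) η := fun η hη x =>
    hasDerivAt_profile (hasDerivAt_const η _) (hasDerivAt_const η _)
      (dQ₁ η (hsub (hsub' hη))) x
  have hne : ∀ p ∈ Ico 0 b ×ˢ Icc (0 : ℝ) 1, D p.1 p.2 ≠ 0 := fun p hp =>
    (Dpos p.1 hp.1 p.2 hp.2).ne'
  have cinv : ContinuousOn (fun p : ℝ × ℝ => 1 / D p.1 p.2) (Ico 0 b ×ˢ Icc 0 1) :=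
    continuousOn_const.div cD hne
  -- derivatives of the total mass
  set φ₁ : ℝ → ℝ := fun η => ∫ x in (0 : ℝ)..1, -D₁ η x / (D η x) ^ 2 with hφ₁
  set φ₂ : ℝ → ℝ := fun η => ∫ x in (0 : ℝ)..1, (-D₂ η x * (D η x) ^ 2
    - -D₁ η x * (2 * D η x * D₁ η x)) / ((D η x) ^ 2) ^ 2 with hφ₂
  have cφ₁' : ContinuousOn (fun p : ℝ × ℝ => -D₁ p.1 p.2 / (D p.1 p.2) ^ 2)
      (Ico 0 b ×ˢ Icc 0 1) := cD₁.neg.div (cD.pow 2) fun p hp => pow_ne_zero 2 (hne p hp)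
  have cφ₂' : ContinuousOn (fun p : ℝ × ℝ => (-D₂ p.1 p.2 * (D p.1 p.2) ^ 2
      - -D₁ p.1 p.2 * (2 * D p.1 p.2 * D₁ p.1 p.2)) / ((D p.1 p.2) ^ 2) ^ 2)
      (Ico 0 b ×ˢ Icc 0 1) :=
    ((cD₂.neg.mul (cD.pow 2)).sub (cD₁.neg.mul ((continuousOn_const.mul cD).mul cD₁))).div
      ((cD.pow 2).pow 2) fun p hp => pow_ne_zero 2 (pow_ne_zero 2 (hne p hp))
  have cφ₁ : ContinuousOn φ₁ (Ico 0 b) :=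
    continuousOn_integral_unit (h := fun η x => -D₁ η x / (D η x) ^ 2) cφ₁'
  have cφ₂ : ContinuousOn φ₂ (Ico 0 b) :=
    continuousOn_integral_unit (h := fun η x => (-D₂ η x * (D η x) ^ 2
      - -D₁ η x * (2 * D η x * D₁ η x)) / ((D η x) ^ 2) ^ 2) cφ₂'
  have dφ : ∀ η ∈ Ioo 0 b, HasDerivAt φ (φ₁ η) η := by
    intro η hη
    refine (hasDerivAt_integral_of_continuousOn (h := fun η x => 1 / D η x)
      (h' := fun η x => -D₁ η x / (D η x) ^ 2) (cinv.mono (prod_mono_left hsub'))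
      (cφ₁'.mono (prod_mono_left hsub')) (fun s hs x hx => ?_) hη
      h01).congr_of_eventuallyEq ?_
    · simpa [one_div] using (dD s hs x).fun_inv (hne (s, x) ⟨hsub' hs, hx⟩)
    · filter_upwards [Ioo_mem_nhds hη.1 hη.2] with s hs using hφD s (hsub' hs)
  have dφ₁ : ∀ η ∈ Ioo 0 b, HasDerivAt φ₁ (φ₂ η) η := by
    intro η hη
    refine hasDerivAt_integral_of_continuousOn (h := fun η x => -D₁ η x / (D η x) ^ 2)
      (h' := fun η x => (-D₂ η x * (D η x) ^ 2
        - -D₁ η x * (2 * D η x * D₁ η x)) / ((D η x) ^ 2) ^ 2)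
      (cφ₁'.mono (prod_mono_left hsub')) (cφ₂'.mono (prod_mono_left hsub'))
      (fun s hs x hx => ?_) hη h01
    refine ((dD₁ s hs x).fun_neg.fun_div ((dD s hs x).fun_pow 2)
      (pow_ne_zero 2 (hne (s, x) ⟨hsub' hs, hx⟩))).congr_deriv ?_
    push_cast
    ring
  have hφle : ∀ η ∈ Ico 0 b, φ η ≤ ∫ x in (0 : ℝ)..1, 1 / (1 - η * F x) := by
    intro η hη
    rw [hφD η hη]
    refine integral_mono_unit (continuousOn_slice (h := fun η x => 1 / D η x) cinv hη)
      (continuousOn_const.div (by fun_prop) fun x hx => (hD0pos η hη x hx).ne')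
      fun x hx => one_div_le_one_div_of_le (hD0pos η hη x hx) ?_
    have := mul_nonneg (hQ η hη) (hR x hx)
    simp only [hD, profile]
    linarith
  have hLφ : ∀ η ∈ Ico 0 b, ∫ μ in (0 : ℝ)..η, φ μ ^ 2 ≤ L := by
    intro η hη
    refine le_trans ?_ (hL η hη)
    have hs : Icc 0 η ⊆ Ico 0 b := fun s hs => ⟨hs.1, hs.2.trans_lt hη.2⟩
    refine intervalIntegral.integral_mono_on hη.1 ?_ ?_ fun μ hμ =>
      pow_le_pow_left₀ (φpos μ (hsub (hs hμ))).le (hφle μ (hs hμ)) 2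
    · refine ContinuousOn.intervalIntegrable ?_
      rw [uIcc_of_le hη.1]
      exact (cφ.mono (hs.trans hsub)).pow 2
    · refine ContinuousOn.intervalIntegrable ?_
      rw [uIcc_of_le hη.1]
      refine (continuousOn_integral_unit (h := fun μ x => 1 / (1 - μ * F x)) ?_).pow 2
      refine continuousOn_const.div (continuousOn_const.sub (continuousOn_fst.mul
        (cF.comp continuousOn_snd fun p hp => hp.2))) fun p hp =>
          (hD0pos p.1 (hs hp.1) p.2 hp.2).ne'
  obtain ⟨T, S, hT0, hTL, hS0, hSm, hSm', cS, dS, hSlim⟩ := exists_time_change hb cφ φpos hLφ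
  have h0b : (0 : ℝ) ∈ Ico 0 b := left_mem_Ico.2 hb
  have φne : ∀ η ∈ Ico 0 b, φ η ≠ 0 := fun η hη => (φpos η (hsub hη)).ne'
  have hD0 : ∀ x, D 0 x = 1 := fun x => by simp [hD, profile, hQ0]
  have hD₁0 : ∀ x, D₁ 0 x = -F x := fun x => by simp [hD₁, profile, hQ₁0]
  have hφ0 : φ 0 = 1 := by
    rw [hφD 0 h0b]
    simp [hD0]
  -- The zero mean of `F` is what makes the initial condition `A₁ 0 = 0` compatible with the mass
  -- constraint.
  have hφ₁0 : φ₁ 0 = 0 := by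
    simp only [hφ₁, hD0, hD₁0, neg_neg, one_pow, div_one, hmean]
  -- By `dη/dt = φ⁻²`, this is the `t`-derivative of `φ` as a function of `η`.
  set ψ : ℝ → ℝ := fun η => φ₁ η / φ η ^ 2 with hψ
  set ψ₁ : ℝ → ℝ := fun η => (φ₂ η * φ η ^ 2 - φ₁ η * (2 * φ η * φ₁ η)) / (φ η ^ 2) ^ 2
    with hψ₁
  have cφ' : ContinuousOn φ (Ico 0 b) := cφ.mono hsub
  have cQ' : ContinuousOn Q (Ico 0 b) := cQ.mono hsub
  have cQ₁' : ContinuousOn Q₁ (Ico 0 b) := cQ₁.mono hsub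
  have cψ : ContinuousOn ψ (Ico 0 b) :=
    cφ₁.div (cφ'.pow 2) fun η hη => pow_ne_zero 2 (φne η hη)
  have cψ₁ : ContinuousOn ψ₁ (Ico 0 b) :=
    ((cφ₂.mul (cφ'.pow 2)).sub (cφ₁.mul ((continuousOn_const.mul cφ').mul cφ₁))).div
      ((cφ'.pow 2).pow 2) fun η hη => pow_ne_zero 2 (pow_ne_zero 2 (φne η hη))
  have dψ : ∀ η ∈ Ioo 0 b, HasDerivAt ψ (ψ₁ η) η := by
    intro η hη
    refine ((dφ₁ η hη).fun_div ((dφ η hη).fun_pow 2)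
      (pow_ne_zero 2 (φne η (hsub' hη)))).congr_deriv ?_
    simp only [hψ₁]
    push_cast
    ring
  have tc : ∀ {k : ℝ → ℝ}, ContinuousOn k (Ico 0 b) →
      ContinuousOn (fun t => k (S t)) (Ico 0 T) := fun hk => hk.comp cS hSm
  have td : ∀ {k : ℝ → ℝ} {k' t : ℝ}, t ∈ Ioo 0 T → HasDerivAt k k' (S t) →
      HasDerivAt (fun t => k (S t)) (k' * (φ (S t) ^ 2)⁻¹) t := fun ht hk =>
    hk.comp _ (dS _ ht)
  -- The first three coefficients expand `φ (1 - η F + Q R)` at `η = S t`, the next three are their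
  -- `t`-derivatives, and `I = -ψ₁ / φ³` is forced by `A'' = -I A`.
  refine ⟨T, fun t => φ (S t), fun t => -(S t * φ (S t)), fun t => φ (S t) * Q (S t),
    fun t => ψ (S t), fun t => -(ψ (S t) * S t) - 1 / φ (S t),
    fun t => ψ (S t) * Q (S t) + Q₁ (S t) / φ (S t), fun t => -(ψ₁ (S t) / φ (S t) ^ 3),
    hT0, hTL, ?_, ?_⟩
  · have key : ∀ η, profile F R (fun t => φ (S t)) (fun t => -(S t * φ (S t)))
        (fun t => φ (S t) * Q (S t)) η = fun x => φ (S η) * D (S η) x := by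
      intro η
      funext x
      simp only [hD, profile]
      ring
    refine
      { cA := tc cφ'
        cB := (cS.mul (tc cφ')).neg
        cP := (tc cφ').mul (tc cQ')
        cA₁ := tc cψ
        cB₁ := ((tc cψ).mul cS).neg.sub
          (continuousOn_const.div (tc cφ') fun t ht => φne _ (hSm ht))
        cP₁ := ((tc cψ).mul (tc cQ')).add ((tc cQ₁').div (tc cφ') fun t ht => φne _ (hSm ht))
        cI := (((tc cψ₁).div ((tc cφ').pow 3)
          fun t ht => pow_ne_zero 3 (φne _ (hSm ht))).neg).mono Ioo_subset_Ico_self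
        dA := ?_, dB := ?_, dP := ?_, dA₁ := ?_, dB₁ := ?_, dP₁ := ?_
        A_zero := by simp only [hS0, hφ0]
        B_zero := by simp [hS0]
        P_zero := by simp [hS0, hQ0]
        A₁_zero := by simp [hS0, hψ, hφ₁0]
        B₁_zero := by simp [hS0, hφ0]
        P₁_zero := by simp [hS0, hQ0, hQ₁0]
        pos := ?_, mass := ?_ }
    · intro t ht
      refine (td ht (dφ _ (hSm' ht))).congr_deriv ?_
      simp only [hψ, div_eq_mul_inv]
    · intro t ht
      have hn := φne _ (hsub' (hSm' ht))
      refine ((dS t ht).fun_mul (td ht (dφ _ (hSm' ht)))).fun_neg.congr_deriv ?_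
      simp only [hψ]
      field_simp
      ring
    · intro t ht
      have hn := φne _ (hsub' (hSm' ht))
      refine ((td ht (dφ _ (hSm' ht))).fun_mul
        (td ht (dQ _ (hsub (hsub' (hSm' ht)))))).congr_deriv ?_
      simp only [hψ]
      field_simp
    · intro t ht
      have hn := φne _ (hsub' (hSm' ht))
      refine (td ht (dψ _ (hSm' ht))).congr_deriv ?_
      field_simp
    · intro t ht
      have hn := φne _ (hsub' (hSm' ht))
      refine (((td ht (dψ _ (hSm' ht))).fun_mul (dS t ht)).fun_neg.fun_sub
        ((hasDerivAt_const t (1 : ℝ)).fun_div (td ht (dφ _ (hSm' ht))) hn)).congr_deriv ?_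
      simp only [hψ]
      field_simp
      ring
    · intro t ht
      have hn := φne _ (hsub' (hSm' ht))
      refine (((td ht (dψ _ (hSm' ht))).fun_mul (td ht (dQ _ (hsub (hsub' (hSm' ht)))))).fun_add
        ((td ht (dQ₁ _ (hsub (hsub' (hSm' ht))))).fun_div (td ht (dφ _ (hSm' ht)))
          hn)).congr_deriv ?_
      change (ψ₁ (S t) * (φ (S t) ^ 2)⁻¹ * Q (S t) + ψ (S t) * (Q₁ (S t) * (φ (S t) ^ 2)⁻¹)
        + (φ (S t) ^ 3 * (φ (S t) ^ 2)⁻¹ * φ (S t) - Q₁ (S t) * (φ₁ (S t) * (φ (S t) ^ 2)⁻¹))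
          / φ (S t) ^ 2) = _
      simp only [hψ]
      field_simp
      ring
    · intro t ht x hx
      rw [key]
      exact mul_pos (φpos _ (hsub (hSm ht))) (Dpos _ (hSm ht) x hx)
    · intro t ht
      have hn := φne _ (hSm ht)
      simp only [key, one_div, mul_inv]
      rw [intervalIntegral.integral_const_mul]
      have := hφD _ (hSm ht)
      simp only [one_div] at this
      rw [← this, inv_mul_cancel₀ hn]
  · intro x hFx hRx
    -- Where `F = M` and `R = 0` the profile reduces to `(1 - η M) φ`, squeezed between `0` and the
    -- expression in `hdecay`.
    have hlim := hdecay.comp hSlim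
    refine squeeze_zero' ?_ ?_ hlim
    · filter_upwards [Ioo_mem_nhdsLT hT0] with t ht
      have hm := hSm (Ioo_subset_Ico_self ht)
      have h1 := one_sub_mul_pos hM hm.2
      have h2 := φpos _ (hsub hm)
      have e : profile F R (fun t => φ (S t)) (fun t => -(S t * φ (S t)))
          (fun t => φ (S t) * Q (S t)) t x = (1 - S t * M) * φ (S t) := by
        simp only [profile, hFx, hRx]
        ring
      rw [e]
      exact (mul_pos h1 h2).le
    · filter_upwards [Ioo_mem_nhdsLT hT0] with t ht
      have hm := hSm (Ioo_subset_Ico_self ht)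
      have h1 := one_sub_mul_pos hM hm.2
      have e : profile F R (fun t => φ (S t)) (fun t => -(S t * φ (S t)))
          (fun t => φ (S t) * Q (S t)) t x = (1 - S t * M) * φ (S t) := by
        simp only [profile, hFx, hRx]
        ring
      rw [e]
      exact mul_le_mul_of_nonneg_left (hφle _ hm) h1.le

/-! ### Strength of the singularity at `η = 1/M`. -/

/-- A function on `[0,1]` attaining its maximum only at endpoints, with nonzero derivative there,
lies below the maximum by a multiple of the distance to the boundary. -/
theorem exists_mul_le_max_sub {F F₁ : ℝ → ℝ} {M : ℝ}
    (dF : ∀ x ∈ Icc (0 : ℝ) 1, HasDerivWithinAt F (F₁ x) (Icc 0 1) x)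
    (hF : ∀ x ∈ Icc (0 : ℝ) 1, F x ≤ M)
    (honly : ∀ x ∈ Icc (0 : ℝ) 1, F x = M → x = 0 ∨ x = 1)
    (hF₁ : ∀ x ∈ Icc (0 : ℝ) 1, F x = M → F₁ x ≠ 0) :
    ∃ c > 0, ∀ x ∈ Icc (0 : ℝ) 1, c * (x * (1 - x)) ≤ M - F x := by
  have hle : ∀ x ∈ Icc (0 : ℝ) 1, 0 ≤ x * (1 - x) := fun x hx =>
    mul_nonneg hx.1 (sub_nonneg.2 hx.2)
  have hle1 : ∀ x ∈ Icc (0 : ℝ) 1, x * (1 - x) ≤ 1 := fun x hx => by nlinarith [hx.1, hx.2]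
  -- The bound is local: compactness of `[0,1]` reduces it to neighbourhoods of points, taking
  -- minima of constants. The repeated membership lets the property be stated for arbitrary sets.
  suffices H : ∃ c > 0, ∀ x ∈ Icc (0 : ℝ) 1, x ∈ Icc (0 : ℝ) 1 →
      c * (x * (1 - x)) ≤ M - F x by
    obtain ⟨c, hc, h⟩ := H
    exact ⟨c, hc, fun x hx => h x hx hx⟩
  refine isCompact_Icc.induction_on (p := fun s => ∃ c > 0, ∀ x ∈ s, x ∈ Icc (0 : ℝ) 1 →
    c * (x * (1 - x)) ≤ M - F x) ⟨1, one_pos, by simp⟩ ?_ ?_ ?_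
  · rintro s t hst ⟨c, hc, h⟩
    exact ⟨c, hc, fun x hx => h x (hst hx)⟩
  · rintro s t ⟨c, hc, h⟩ ⟨c', hc', h'⟩
    refine ⟨min c c', lt_min hc hc', ?_⟩
    rintro x (hx | hx) hxI
    · exact (mul_le_mul_of_nonneg_right (min_le_left _ _) (hle x hxI)).trans (h x hx hxI)
    · exact (mul_le_mul_of_nonneg_right (min_le_right _ _) (hle x hxI)).trans (h' x hx hxI)
  · intro x₀ hx₀
    rcases (hF x₀ hx₀).lt_or_eq with hlt | heq
    · have hc : 0 < (M - F x₀) / 2 := by linarith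
      have hev : ∀ᶠ x in 𝓝[Icc 0 1] x₀, F x < (M + F x₀) / 2 :=
        (dF x₀ hx₀).continuousWithinAt.tendsto.eventually (gt_mem_nhds (by linarith))
      refine ⟨_, hev, (M - F x₀) / 2, hc, fun x hx hxI => ?_⟩
      have := mul_le_of_le_one_right hc.le (hle1 x hxI)
      have hx' : F x < (M + F x₀) / 2 := hx
      linarith
    · have hd := dF x₀ hx₀
      rw [hasDerivWithinAt_iff_tendsto_slope] at hd
      have hpos : 0 < |F₁ x₀| := abs_pos.2 (hF₁ x₀ hx₀ heq)
      -- Near a maximum point the slope is at least half the nonzero derivative in absolute value,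
      -- so `M - F` grows at least linearly.
      have hev : ∀ᶠ x in 𝓝[Icc 0 1 \ {x₀}] x₀, |F₁ x₀| / 2 < |slope F x₀ x| :=
        hd.abs.eventually (lt_mem_nhds (by linarith))
      rw [eventually_nhdsWithin_iff] at hev
      refine ⟨_, mem_nhdsWithin_of_mem_nhds hev, |F₁ x₀| / 2, by positivity, fun x hx hxI => ?_⟩
      have hdist : x * (1 - x) ≤ |x - x₀| := by
        rcases honly x₀ hx₀ heq with rfl | rfl
        · rw [sub_zero, abs_of_nonneg hxI.1]
          nlinarith [hxI.1, hxI.2]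
        · rw [abs_of_nonpos (by linarith [hxI.2])]
          nlinarith [hxI.1, hxI.2]
      by_cases hxx : x = x₀
      · have : x * (1 - x) ≤ 0 := by simpa [hxx] using hdist
        have h0 := hF x hxI
        nlinarith
      · have h1 := hx ⟨hxI, hxx⟩
        have hp : 0 < |x - x₀| := abs_pos.2 (sub_ne_zero.2 hxx)
        rw [slope_def_field, abs_div, lt_div_iff₀ hp, heq, abs_sub_comm (F x),
          abs_of_nonneg (sub_nonneg.2 (hF x hxI))] at h1
        exact (mul_le_mul_of_nonneg_left hdist (by positivity)).trans h1.le

/-- If `F` is below its maximum `M` by a multiple of the distance to the boundary, then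
`∫₀¹ dx / (1 - μ F)` blows up at most like `(1 - μ M)^(-1/4)`. -/
theorem exists_integral_inv_le_rpow {F : ℝ → ℝ} {M c : ℝ} (cF : ContinuousOn F (Icc 0 1))
    (hF : ∀ x ∈ Icc (0 : ℝ) 1, F x ≤ M) (hM : 0 < M) (hc : 0 < c)
    (hd : ∀ x ∈ Icc (0 : ℝ) 1, c * (x * (1 - x)) ≤ M - F x) :
    ∃ C, 0 ≤ C ∧ ∀ μ ∈ Ico 0 (1 / M),
      ∫ x in (0 : ℝ)..1, 1 / (1 - μ * F x) ≤ C * (1 - μ * M) ^ (-(1 / 4) : ℝ) := by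
  -- Chosen so that `2 e ≤ 1` and `2 e M ≤ c`; then `1 - μ F = (1 - μ M) + μ (M - F)` is at least `2
  -- e x (1 - x)` uniformly in `μ`. The factor `2` absorbs `1 - x ≥ 1/2` or `x ≥ 1/2` on the two
  -- halves.
  set e : ℝ := min 1 (c / M) / 2 with he
  have he0 : 0 < e := by positivity
  have i1 : IntervalIntegrable (fun x : ℝ => x ^ (-(3 / 4) : ℝ)) volume 0 1 :=
    intervalIntegral.intervalIntegrable_rpow' (by norm_num)
  have i2 : IntervalIntegrable (fun x : ℝ => (1 - x) ^ (-(3 / 4) : ℝ)) volume 0 1 := by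
    have := i1.comp_sub_left 1
    simp only [sub_zero, sub_self] at this
    exact this.symm
  set g : ℝ → ℝ := fun x => e ^ (-(3 / 4) : ℝ) *
    (x ^ (-(3 / 4) : ℝ) + (1 - x) ^ (-(3 / 4) : ℝ)) with hg
  have ig : IntervalIntegrable g volume 0 1 := (i1.add i2).const_mul _
  refine ⟨∫ x in (0 : ℝ)..1, g x, intervalIntegral.integral_nonneg zero_le_one fun x hx => ?_,
    fun μ hμ => ?_⟩
  · have := Real.rpow_nonneg hx.1 (-(3 / 4) : ℝ)
    have := Real.rpow_nonneg (sub_nonneg.2 hx.2) (-(3 / 4) : ℝ)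
    positivity
  · have ha := one_sub_mul_pos hM hμ.2
    have hden : ∀ x ∈ Icc (0 : ℝ) 1, 1 - μ * M ≤ 1 - μ * F x := fun x hx => by
      have := mul_le_mul_of_nonneg_left (hF x hx) hμ.1
      linarith
    rw [← intervalIntegral.integral_mul_const]
    refine intervalIntegral.integral_mono_on_of_le_Ioo zero_le_one ?_ (ig.mul_const _) ?_
    · exact intervalIntegrable_of_continuousOn_unit (continuousOn_const.div (by fun_prop)
        fun x hx => (ha.trans_le (hden x hx)).ne') (right_mem_Icc.2 zero_le_one)
    · intro x hx
      have hxI := Ioo_subset_Icc_self hx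
      have hx0 := hx.1
      have hx1 : 0 < 1 - x := sub_pos.2 hx.2
      have hD := ha.trans_le (hden x hxI)
      have hlow : 2 * e * (x * (1 - x)) ≤ 1 - μ * F x := by
        have h1 : 2 * e ≤ 1 := by rw [he]; linarith [min_le_left 1 (c / M)]
        have h2 : 2 * e * M ≤ c := by
          have : 2 * e ≤ c / M := by rw [he]; linarith [min_le_right 1 (c / M)]
          rwa [le_div_iff₀ hM] at this
        have h3 : x * (1 - x) ≤ 1 := by nlinarith
        have h4 : 0 < x * (1 - x) := by positivity
        have h5 : 2 * e * M * (x * (1 - x)) ≤ M - F x :=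
          (mul_le_mul_of_nonneg_right h2 h4.le).trans (hd x hxI)
        have h6 := mul_le_mul_of_nonneg_left h5 hμ.1
        have h7 : 2 * e * (x * (1 - x)) ≤ 1 := by nlinarith
        nlinarith [mul_le_mul_of_nonneg_left h7 ha.le]
      -- The power `-3/4` is bounded by an integrable function of `x`, and the power `-1/4` by its
      -- value at the maximum. Any exponent strictly between `-1/2` and `0` in place of `-1/4` would
      -- leave both `x` and, after squaring, `μ` integrable.
      have hsplit : 1 / (1 - μ * F x)
          = (1 - μ * F x) ^ (-(3 / 4) : ℝ) * (1 - μ * F x) ^ (-(1 / 4) : ℝ) := by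
        rw [← Real.rpow_add hD, one_div, ← Real.rpow_neg_one]
        norm_num
      rw [hsplit]
      refine mul_le_mul ?_ (Real.rpow_le_rpow_of_nonpos ha (hden x hxI) (by norm_num))
        (Real.rpow_nonneg hD.le _) ?_
      · rcases le_total x (1 / 2) with h | h
        · have h1 : e * x ≤ 1 - μ * F x := by
            nlinarith [mul_pos he0 hx0]
          have h2 := Real.rpow_le_rpow_of_nonpos (z := (-(3 / 4) : ℝ)) (mul_pos he0 hx0) h1
            (by norm_num)
          rw [Real.mul_rpow he0.le hx0.le] at h2
          refine h2.trans (mul_le_mul_of_nonneg_left ?_ (Real.rpow_nonneg he0.le _))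
          exact le_add_of_nonneg_right (Real.rpow_nonneg hx1.le _)
        · have h1 : e * (1 - x) ≤ 1 - μ * F x := by
            nlinarith [mul_pos he0 hx1]
          have h2 := Real.rpow_le_rpow_of_nonpos (z := (-(3 / 4) : ℝ)) (mul_pos he0 hx1) h1
            (by norm_num)
          rw [Real.mul_rpow he0.le hx1.le] at h2
          refine h2.trans (mul_le_mul_of_nonneg_left ?_ (Real.rpow_nonneg he0.le _))
          exact le_add_of_nonneg_left (Real.rpow_nonneg hx0.le _)
      · positivity

/-- Squaring turns the exponent `-1/4` into `-1/2`, and `(1 - μ M)^(-1/2)` has the bounded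
antiderivative `-(2/M) √(1 - μ M)`. -/
theorem integral_sq_le_of_le_rpow {Φ : ℝ → ℝ} {M C : ℝ} (hM : 0 < M)
    (cΦ : ContinuousOn Φ (Ico 0 (1 / M))) (hΦ0 : ∀ μ ∈ Ico 0 (1 / M), 0 ≤ Φ μ)
    (hΦ : ∀ μ ∈ Ico 0 (1 / M), Φ μ ≤ C * (1 - μ * M) ^ (-(1 / 4) : ℝ)) {η : ℝ}
    (hη : η ∈ Ico 0 (1 / M)) : ∫ μ in (0 : ℝ)..η, Φ μ ^ 2 ≤ C ^ 2 * (2 / M) := by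
  have hs : Icc 0 η ⊆ Ico 0 (1 / M) := fun s hs => ⟨hs.1, hs.2.trans_lt hη.2⟩
  have ha : ∀ μ ∈ Icc 0 η, 0 < 1 - μ * M := fun μ hμ => one_sub_mul_pos hM (hs hμ).2
  have hsq : ∀ μ ∈ Icc 0 η, ((1 - μ * M) ^ (-(1 / 4) : ℝ)) ^ 2 = 1 / √(1 - μ * M) := by
    intro μ hμ
    rw [← Real.rpow_natCast, ← Real.rpow_mul (ha μ hμ).le, Real.sqrt_eq_rpow, one_div (_ ^ _),
      ← Real.rpow_neg (ha μ hμ).le]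
    norm_num
  have cs : ContinuousOn (fun μ => C ^ 2 * (1 / √(1 - μ * M))) (Icc 0 η) := by
    refine continuousOn_const.mul (continuousOn_const.div ?_ fun μ hμ =>
      (Real.sqrt_pos.2 (ha μ hμ)).ne')
    fun_prop
  have hint : ∫ μ in (0 : ℝ)..η, Φ μ ^ 2 ≤ ∫ μ in (0 : ℝ)..η, C ^ 2 * (1 / √(1 - μ * M)) := by
    refine intervalIntegral.integral_mono_on hη.1 ?_ ?_ fun μ hμ => ?_
    · refine ContinuousOn.intervalIntegrable ?_
      rw [uIcc_of_le hη.1]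
      exact (cΦ.mono hs).pow 2
    · refine ContinuousOn.intervalIntegrable ?_
      rwa [uIcc_of_le hη.1]
    · rw [← hsq μ hμ, ← mul_pow]
      exact pow_le_pow_left₀ (hΦ0 μ (hs hμ)) (hΦ μ (hs hμ)) 2
  refine hint.trans ?_
  rw [intervalIntegral.integral_eq_sub_of_hasDerivAt
    (f := fun μ => -(C ^ 2 * (2 / M) * √(1 - μ * M)))]
  · have : 0 ≤ C ^ 2 * (2 / M) * √(1 - η * M) := by positivity
    simp only [zero_mul, sub_zero, Real.sqrt_one, mul_one]
    linarith
  · intro μ hμ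
    rw [uIcc_of_le hη.1] at hμ
    have h1 : HasDerivAt (fun μ : ℝ => 1 - μ * M) (-M) μ := by
      simpa using ((hasDerivAt_id μ).mul_const M).const_sub 1
    refine ((h1.sqrt (ha μ hμ).ne').const_mul (C ^ 2 * (2 / M))).fun_neg.congr_deriv ?_
    have := (Real.sqrt_pos.2 (ha μ hμ)).ne'
    field_simp
  · refine ContinuousOn.intervalIntegrable ?_
    rwa [uIcc_of_le hη.1]

/-- The product is at most `C (1 - η M)^(3/4)`. -/
theorem tendsto_mul_of_le_rpow {Φ : ℝ → ℝ} {M C : ℝ} (hM : 0 < M)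
    (hΦ0 : ∀ μ ∈ Ico 0 (1 / M), 0 ≤ Φ μ)
    (hΦ : ∀ μ ∈ Ico 0 (1 / M), Φ μ ≤ C * (1 - μ * M) ^ (-(1 / 4) : ℝ)) :
    Tendsto (fun η => (1 - η * M) * Φ η) (𝓝[<] (1 / M)) (𝓝 0) := by
  have hb : 0 < 1 / M := by positivity
  have hlim : Tendsto (fun η => C * (1 - η * M) ^ (3 / 4 : ℝ)) (𝓝[<] (1 / M)) (𝓝 0) := by
    have hc : Continuous fun η : ℝ => C * (1 - η * M) ^ (3 / 4 : ℝ) :=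
      continuous_const.mul ((by fun_prop : Continuous fun η : ℝ => 1 - η * M).rpow_const
        fun _ => Or.inr (by norm_num))
    have := hc.tendsto (1 / M)
    rw [one_div_mul_cancel hM.ne', sub_self, Real.zero_rpow (by norm_num), mul_zero] at this
    exact this.mono_left nhdsWithin_le_nhds
  refine squeeze_zero' ?_ ?_ hlim
  · filter_upwards [Ioo_mem_nhdsLT hb] with η hη
    exact mul_nonneg (one_sub_mul_pos hM hη.2).le (hΦ0 η (Ioo_subset_Ico_self hη))
  · filter_upwards [Ioo_mem_nhdsLT hb] with η hη
    have ha := one_sub_mul_pos hM hη.2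
    refine (mul_le_mul_of_nonneg_left (hΦ η (Ioo_subset_Ico_self hη)) ha.le).trans_eq ?_
    rw [mul_left_comm]
    congr 1
    nth_rewrite 1 [← Real.rpow_one (1 - η * M)]
    rw [← Real.rpow_add ha]
    norm_num

theorem exists_tendsto_integral_sq {Φ : ℝ → ℝ} {b K : ℝ} (hb : 0 < b)
    (cΦ : ContinuousOn Φ (Ico 0 b)) (hK : ∀ η ∈ Ico 0 b, ∫ μ in (0 : ℝ)..η, Φ μ ^ 2 ≤ K) :
    ∃ L, Tendsto (fun η => ∫ μ in (0 : ℝ)..η, Φ μ ^ 2) (𝓝[<] b) (𝓝 L) ∧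
      ∀ η ∈ Ico 0 b, ∫ μ in (0 : ℝ)..η, Φ μ ^ 2 ≤ L := by
  have hmono : MonotoneOn (fun η => ∫ μ in (0 : ℝ)..η, Φ μ ^ 2) (Ico 0 b) := by
    intro x hx y hy hxy
    refine intervalIntegral.integral_mono_interval le_rfl hx.1 hxy
      (Eventually.of_forall fun _ => sq_nonneg _) (ContinuousOn.intervalIntegrable ?_)
    rw [uIcc_of_le hy.1]
    exact (cΦ.mono fun s hs => ⟨hs.1, hs.2.trans_lt hy.2⟩).pow 2
  have hlim := (hmono.mono Ioo_subset_Ico_self).tendsto_nhdsWithin_Ioo_left (nonempty_Ioo.2 hb)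
    ⟨K, by rintro _ ⟨η, hη, rfl⟩; exact hK η (Ioo_subset_Ico_self hη)⟩
  refine ⟨_, hlim, fun η hη => ge_of_tendsto hlim ?_⟩
  filter_upwards [Ioo_mem_nhdsLT hη.2] with s hs
  exact hmono hη ⟨hη.1.trans hs.1.le, hs.2⟩ hs.1.le

/-! ### The main theorem. -/

theorem theorem3p2 (f₀ ρ₀ : ℝ → ℝ) (M₀ : ℝ)
    (hf₀ : ContDiffOn ℝ ∞ f₀ (Icc 0 1)) (hρ₀ : ContDiffOn ℝ ∞ ρ₀ (Icc 0 1))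
    (hf₀_bdry : f₀ 0 = 0 ∧ f₀ 1 = 0) (hρ₀_bdry : ρ₀ 0 = 0 ∧ ρ₀ 1 = 0)
    (hρ₀_nonneg : ∀ x ∈ Icc (0 : ℝ) 1, 0 ≤ ρ₀ x)
    (hM₀ : IsGreatest (dX f₀ '' Icc 0 1) M₀) (hM₀_pos : 0 < M₀)
    (h_only : ∀ x ∈ Icc (0 : ℝ) 1, dX f₀ x = M₀ → x = 0 ∨ x = 1)
    (h_vort : ∀ x ∈ Icc (0 : ℝ) 1, dX f₀ x = M₀ → dX (dX f₀) x ≠ 0) :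
    ∃ tstar : ℝ, 0 < tstar ∧
      -- the explicit upper bound, the limit being finite
      (∃ L : ℝ,
        Tendsto (fun η : ℝ =>
            ∫ μ in (0 : ℝ)..η, (∫ x in (0 : ℝ)..1, 1 / (1 - μ * dX f₀ x)) ^ 2)
          (𝓝[<] (1 / M₀)) (𝓝 L) ∧
        tstar ≤ L) ∧
      -- the solution exists on `[0, tstar)`, is unique, cannot be continued, and blows up
      ∃ f ρ : ℝ → ℝ → ℝ, IsDirichletSolution f₀ ρ₀ tstar f ρ ∧
        (∀ (T : ℝ) (g σ : ℝ → ℝ → ℝ), IsDirichletSolution f₀ ρ₀ T g σ →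
          T ≤ tstar ∧ ∀ t ∈ Ico 0 T, ∀ x ∈ Icc (0 : ℝ) 1, g t x = f t x ∧ σ t x = ρ t x) ∧
        ∀ x ∈ Icc (0 : ℝ) 1, dX f₀ x = M₀ →
          Tendsto (fun t : ℝ => ∫ s in (0 : ℝ)..t, dX (f s) x) (𝓝[<] tstar) atTop := by
  have hud : UniqueDiffOn ℝ (Icc (0 : ℝ) 1) := uniqueDiffOn_Icc zero_lt_one
  have cd : ∀ {u : ℝ → ℝ}, ContDiffOn ℝ ∞ u (Icc 0 1) →
      (∀ x ∈ Icc (0 : ℝ) 1, HasDerivWithinAt u (dX u x) (Icc 0 1) x) ∧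
      ContDiffOn ℝ ∞ (dX u) (Icc 0 1) := fun hu => by
    have := (contDiffOn_infty_iff_derivWithin hud).1 hu
    exact ⟨fun x hx => (this.1 x hx).hasDerivWithinAt, this.2⟩
  obtain ⟨df₀, sF⟩ := cd hf₀
  obtain ⟨dF, sF₁⟩ := cd sF
  obtain ⟨dR, sR₁⟩ := cd hρ₀
  have cF := sF.continuousOn
  have hF : ∀ x ∈ Icc (0 : ℝ) 1, dX f₀ x ≤ M₀ := fun x hx => hM₀.2 (mem_image_of_mem _ hx)
  have hb : 0 < 1 / M₀ := by positivity
  have hmean : ∫ x in (0 : ℝ)..1, dX f₀ x = 0 := by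
    rw [integral_eq_sub_of_hasDerivWithinAt_unit df₀ cF (right_mem_Icc.2 zero_le_one),
      hf₀_bdry.1, hf₀_bdry.2, sub_zero]
  obtain ⟨c, hc, hd⟩ := exists_mul_le_max_sub dF hF h_only h_vort
  obtain ⟨C, -, hC⟩ := exists_integral_inv_le_rpow cF hF hM₀_pos hc hd
  set Φ : ℝ → ℝ := fun μ => ∫ x in (0 : ℝ)..1, 1 / (1 - μ * dX f₀ x) with hΦ
  have hden : ∀ μ ∈ Ico 0 (1 / M₀), ∀ x ∈ Icc (0 : ℝ) 1, 0 < 1 - μ * dX f₀ x := by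
    intro μ hμ x hx
    have h1 := one_sub_mul_pos hM₀_pos hμ.2
    have h2 := mul_le_mul_of_nonneg_left (hF x hx) hμ.1
    linarith
  have cΦ : ContinuousOn Φ (Ico 0 (1 / M₀)) :=
    continuousOn_integral_unit (h := fun μ x => 1 / (1 - μ * dX f₀ x))
      (continuousOn_const.div (continuousOn_const.sub (continuousOn_fst.mul
        (cF.comp continuousOn_snd fun p hp => hp.2))) fun p hp =>
          (hden p.1 hp.1 p.2 hp.2).ne')
  have hΦ0 : ∀ μ ∈ Ico 0 (1 / M₀), 0 ≤ Φ μ := fun μ hμ =>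
    intervalIntegral.integral_nonneg zero_le_one fun x hx => (one_div_pos.2 (hden μ hμ x hx)).le
  obtain ⟨L, hLlim, hL⟩ := exists_tendsto_integral_sq hb cΦ fun η hη =>
    integral_sq_le_of_le_rpow hM₀_pos cΦ hΦ0 hC hη
  obtain ⟨T, A, B, P, A₁, B₁, P₁, I, hT0, hTL, hflow, hzero⟩ := exists_flowCoeff cF
    hρ₀.continuousOn hρ₀_nonneg hF hM₀_pos hmean hL (tendsto_mul_of_le_rpow hM₀_pos hΦ0 hC)
  obtain ⟨f, ρ, hsol, hlog⟩ := hflow.exists_solution df₀ dF dR sF₁.continuousOn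
    sR₁.continuousOn hT0 hf₀_bdry hρ₀_bdry
  have hblow : ∀ x ∈ Icc (0 : ℝ) 1, dX f₀ x = M₀ →
      Tendsto (fun t : ℝ => ∫ s in (0 : ℝ)..t, dX (f s) x) (𝓝[<] T) atTop := by
    intro x hx hxM
    have hx01 := h_only x hx hxM
    have hR0 : ρ₀ x = 0 := by
      rcases hx01 with rfl | rfl
      exacts [hρ₀_bdry.1, hρ₀_bdry.2]
    have hmem : ∀ᶠ t in 𝓝[<] T, t ∈ Ico 0 T := by
      filter_upwards [Ioo_mem_nhdsLT hT0] with t ht using Ioo_subset_Ico_self ht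
    have hlim := tendsto_nhdsWithin_iff.2
      ⟨hzero x hxM hR0, hmem.mono fun t ht => hflow.pos t ht x hx⟩
    -- The integral of `f_x` at this endpoint is `-log w`, and `w` tends to `0` through positive
    -- values.
    refine (tendsto_neg_atBot_atTop.comp (Real.tendsto_log_nhdsGT_zero.comp hlim)).congr' ?_
    exact hmem.mono fun t ht => (hlog x hx01 t ht).symm
  refine ⟨T, hT0, ⟨L, hLlim, hTL⟩, f, ρ, hsol, fun T' g σ hg => ?_, hblow⟩
  -- Blowup at a single maximum point is enough to rule out continuation.
  obtain ⟨x, hx, hxM⟩ := hM₀.1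
  have hle := hsol.le_of_blowup hT0 hx (hblow x hx hxM) hg
  exact ⟨hle, hg.unique (hsol.mono hle)⟩
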